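/- Let $p\in(1,\infty)$. For an immersed planar curve $c\in W^{2,p}(0,1;\mathbf R^2)$ (represented by its $C^1$ representative on $[0,1]$, with $c'(t)\neq 0$ for all $t\in[0,1]$) with signed curvature $k=\det(c',c'')/|c'|^3$, let $$\mathcal B_p[c]=\int_0^1|k|^p\,|c'|\,dt,\qquad \mathcal L[c]=\int_0^1|c'|\,dt .$$ Such a curve $c$ is called a $p$-elastica if there is $\lambda\in\mathbf R$ such that $$\frac{d}{d\varepsilon}\Big(\mathcal B_p[c+\varepsilon\eta]+\lambda\,\mathcal L[c+\varepsilon\eta]\Big)\Big|_{\varepsilon=0}=0\qquad\text{for all }\eta\in C_c^\infty(0,1;\mathbf R^2).$$ **Theorem 1.3.** Let $p\in(1,\infty)$, let $L>0$, and let $\gamma:[0,L]\to\mathbf R^2$ be an arclength-parameterized $p$-elastica, i.e. the arclength parameterization of a $p$-elastica of length $L$. Then $\gamma\in W^{3,1}(0,L;\mathbf R^2)$; in particular $\gamma\in C^2([0,L];\mathbf R^2)$. In addition, let $k:[0,L]\to\mathbf R$ be the signed curvature of $\gamma$, let $Z=\{s\in[0,L] : k(s)=0\}$, and let $\partial Z$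 be the topological boundary of $Z$ relative to $[0,L]$. Then $\gamma$ is real analytic on $[0,L]\setminus\partial Z$ (at an end point of $[0,L]$ this means that $\gamma$ is given by a convergent power series on a one-sided neighborhood). -/

import Mathlib

open MeasureTheory Set
open scoped ContDiff ENNReal

noncomputable section

namespace PElastica

/-- The Euclidean plane `ℝ²`. -/
abbrev Plane : Type := EuclideanSpace ℝ (Fin 2)

/-- `φ ∈ C_c^∞(a, b; F)`, extended by zero to all of `ℝ`. -/
def IsTestFunction {F : Type*} [NormedAddCommGroup F] [NormedSpace ℝ F]
    (a b : ℝ) (φ : ℝ → F) : Prop :=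
  ContDiff ℝ ∞ φ ∧ HasCompactSupport φ ∧ tsupport φ ⊆ Ioo a b

/-- `g` is the weak (distributional) derivative of `f` on the open interval `(a, b)`. -/
def HasWeakDeriv {F : Type*} [NormedAddCommGroup F] [NormedSpace ℝ F]
    (a b : ℝ) (f g : ℝ → F) : Prop :=
  LocallyIntegrableOn f (Ioo a b) ∧ LocallyIntegrableOn g (Ioo a b) ∧
    ∀ φ : ℝ → ℝ, IsTestFunction a b φ →
      ∫ t in Ioo a b, deriv φ t • f t = -∫ t in Ioo a b, φ t • g t

/-- `f ∈ W^{m,q}(a, b; F)`: the function and its weak derivatives up to order `m` exist and lie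
in `L^q(a, b; F)`; `g j` is the weak derivative of order `j`. -/
def MemSobolev {F : Type*} [NormedAddCommGroup F] [NormedSpace ℝ F]
    (m : ℕ) (q : ℝ≥0∞) (a b : ℝ) (f : ℝ → F) : Prop :=
  ∃ g : ℕ → ℝ → F, g 0 = f ∧
    (∀ j ≤ m, MemLp (g j) q (volume.restrict (Ioo a b))) ∧
    (∀ j < m, HasWeakDeriv a b (g j) (g (j + 1)))

/-- The derivative of a curve on `[a, b]`, one-sided at the end points. -/
def velocity (a b : ℝ) (c : ℝ → Plane) (t : ℝ) : Plane :=
  derivWithin c (Icc a b) t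

/-- The second derivative of a curve on `[a, b]`, one-sided at the end points. For a curve of
class `W^{2,p}` it exists at almost every point and agrees there with the weak second
derivative. -/
def acceleration (a b : ℝ) (c : ℝ → Plane) (t : ℝ) : Plane :=
  derivWithin (velocity a b c) (Icc a b) t

/-- The signed curvature `det(c', c'') / |c'|³` of a curve on `[a, b]`. -/
def signedCurvature (a b : ℝ) (c : ℝ → Plane) (t : ℝ) : ℝ :=
  (velocity a b c t 0 * acceleration a b c t 1 - velocity a b c t 1 * acceleration a b c t 0) /
    ‖velocity a b c t‖ ^ 3

/-- The length of a curve on `[a, b]`. -/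
def curveLength (a b : ℝ) (c : ℝ → Plane) : ℝ :=
  ∫ t in Ioo a b, ‖velocity a b c t‖

/-- The `p`-bending energy `∫ |k|^p ds` of a curve on `[a, b]`, where `ds = |c'| dt`. -/
def bendingEnergy (p a b : ℝ) (c : ℝ → Plane) : ℝ :=
  ∫ t in Ioo a b, |signedCurvature a b c t| ^ p * ‖velocity a b c t‖

/-- Immersed curves of class `W^{2,p}(0, 1; ℝ²)`. As usual an element of the Sobolev space is
identified with its continuous (hence `C¹`) representative on `[0, 1]`. -/
structure IsSobolevImmersion (p : ℝ) (c : ℝ → Plane) : Prop where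
  continuousOn : ContinuousOn c (Icc 0 1)
  memSobolev : MemSobolev 2 (ENNReal.ofReal p) 0 1 c
  velocity_ne_zero : ∀ t ∈ Icc (0 : ℝ) 1, velocity 0 1 c t ≠ 0

/-- A `p`-elastica: an immersed curve `c ∈ W^{2,p}(0, 1; ℝ²)` which is, for some `lam`, a critical
point of (`p`-bending energy) + `lam` * (length) under perturbations in `C_c^∞(0, 1; ℝ²)`. -/
def IsPElastica (p : ℝ) (c : ℝ → Plane) : Prop :=
  IsSobolevImmersion p c ∧
    ∃ lam : ℝ, ∀ η : ℝ → Plane, IsTestFunction 0 1 η →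
      HasDerivAt (fun ε : ℝ =>
        bendingEnergy p 0 1 (c + ε • η) + lam * curveLength 0 1 (c + ε • η)) 0 0

/-- `γ : [0, L] → ℝ²` is the arclength parameterization of the curve `c : [0, 1] → ℝ²`:
`L` is the length of `c`, and `γ (s(t)) = c t`, where `s(t)` is the length of `c` on `[0, t]`. -/
def IsArclengthParameterization (c : ℝ → Plane) (L : ℝ) (γ : ℝ → Plane) : Prop :=
  curveLength 0 1 c = L ∧
    ∀ t ∈ Icc (0 : ℝ) 1, γ (∫ r in Ioo (0 : ℝ) t, ‖velocity 0 1 c r‖) = c t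

/-- `γ : [0, L] → ℝ²` is an arclength parameterized `p`-elastica, that is, the arclength
parameterization of a `p`-elastica. -/
def IsArclengthPElastica (p L : ℝ) (γ : ℝ → Plane) : Prop :=
  ∃ c : ℝ → Plane, IsPElastica p c ∧ IsArclengthParameterization c L γ

/-- The zero set in `[0, L]` of the signed curvature. -/
def curvatureZeroSet (L : ℝ) (γ : ℝ → Plane) : Set ℝ :=
  {s | s ∈ Icc 0 L ∧ signedCurvature 0 L γ s = 0}

/-- The boundary of `A ∩ Z` relative to `A`, that is, in the subspace topology of `A`. -/
def relBoundary (A Z : Set ℝ) : Set ℝ :=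
  Subtype.val '' frontier ((Subtype.val : A → ℝ) ⁻¹' Z)

end PElastica

end

/-! Write T for the unit tangent, N = (-T₁, T₀), k for the curvature and w = |k|^{p-2} k, so that k
= `spow (p - 1)⁻¹ w`. Energy and length involve only derivatives of the curve. The weak
Euler–Lagrange equation therefore contains only φ' and φ'', and the du Bois-Reymond lemma integrates
it once more than usual. This produces a constant vector C with p w' = C·N and (p - 1)|k|^p - lam =
C·T in the arclength parameter, together with T' = k N (`IsSobolevRep.euler_lagrange`,
`exists_isElasticaFrame`). Hence w is C¹, k is continuous and γ is C².

For W^{3,1} it must be shown that k is absolutely continuous. For p > 2 the exponent (p - 1)⁻¹ is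
less than one, so `spow (p - 1)⁻¹` is not Lipschitz at 0, and the regularity of w alone is not
enough. The two identities imply p w'' = k (lam - (p - 1)|k|^p) and the first integral (p w')² + ((p
- 1)|k|^p - lam)² = |C|². From these, w w' is nondecreasing near every zero of w
(`IsElasticaFrame.eventually_deriv_mul_nonneg`). So |w| grows away from the zero on both sides, the
nearby zeros fill an interval, and k is monotone on each side. A continuous monotone function which
is differentiable where it is nonzero is then the integral of its derivative
(`isPrimitive_spow_right`). These local statements are glued by connectedness of the interval.

For analyticity off the boundary of the zero set, note that where w ≠ 0 the quantities γ, T, k,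
w'/w, k/w and the constant 1 satisfy an autonomous system y' = Q(y, y) with Q bilinear. In the
interior of the zero set the same system holds with k, w'/w and k/w replaced by 0. Solutions of such
a system are analytic up to the end points (`analyticWithinAt_of_quadratic_ode`): a convergent power
series solves the initial value problem, and solutions are unique. -/

namespace PElastica

open Filter Topology

/-! ### Analyticity of solutions of quadratic differential equations. -/

section QuadraticODE

variable {E : Type*} [NormedAddCommGroup E] [NormedSpace ℝ E]

/-- The Cauchy product of two absolutely convergent series with respect to a bounded bilinear
map. -/
theorem hasSum_bilin_antidiagonal [CompleteSpace E] (Q : E →L[ℝ] E →L[ℝ] E) {f : ℕ → E}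
    (hf : Summable fun n => ‖f n‖) :
    HasSum (fun n => ∑ ij ∈ Finset.HasAntidiagonal.antidiagonal n, Q (f ij.1) (f ij.2))
      (Q (∑' n, f n) (∑' n, f n)) := by
  have hs : HasSum f (∑' n, f n) := hf.of_norm.hasSum
  have h1 : Summable fun ij : ℕ × ℕ => Q (f ij.1) (f ij.2) := by
    have h2 : Summable fun ij : ℕ × ℕ => ‖Q‖ * (‖f ij.1‖ * ‖f ij.2‖) :=
      (hf.mul_of_nonneg hf (fun _ => norm_nonneg _) (fun _ => norm_nonneg _)).mul_left _
    refine Summable.of_norm_bounded h2 fun ij => ?_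
    rw [← mul_assoc]
    exact Q.le_opNorm₂ _ _
  have h3 : HasSum (fun ij : ℕ × ℕ => Q (f ij.1) (f ij.2)) (Q (∑' n, f n) (∑' n, f n)) := by
    have h4 : ∀ i, HasSum (fun j => Q (f i) (f j)) (Q (f i) (∑' n, f n)) := fun i =>
      (Q (f i)).hasSum hs
    have h5 := h1.hasSum.prod_fiberwise h4
    have h6 : HasSum (fun i => Q (f i) (∑' n, f n)) (Q (∑' n, f n) (∑' n, f n)) :=
      (Q.flip (∑' n, f n)).hasSum hs
    rw [h6.unique h5]
    exact h1.hasSum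
  have h7 := (Finset.HasAntidiagonal.sigmaAntidiagonalEquivProd (A := ℕ)).hasSum_iff.2 h3
  refine h7.sigma fun n => ?_
  have := Finset.hasSum (Finset.HasAntidiagonal.antidiagonal n) (fun ij : ℕ × ℕ => Q (f ij.1) (f ij.2))
  exact this

/-- The Taylor coefficients of the solution of `y' = Q(y, y)`, `y(0) = y₀`. -/
noncomputable def quadCoeff (Q : E →L[ℝ] E →L[ℝ] E) (y₀ : E) : ℕ → E
  | 0 => y₀
  | n + 1 => ((n : ℝ) + 1)⁻¹ •
      ∑ i : Fin (n + 1), Q (quadCoeff Q y₀ i) (quadCoeff Q y₀ (n - i))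
  decreasing_by all_goals omega

theorem quadCoeff_succ (Q : E →L[ℝ] E →L[ℝ] E) (y₀ : E) (n : ℕ) :
    ((n : ℝ) + 1) • quadCoeff Q y₀ (n + 1) =
      ∑ ij ∈ Finset.HasAntidiagonal.antidiagonal n, Q (quadCoeff Q y₀ ij.1) (quadCoeff Q y₀ ij.2) := by
  have h : ((n : ℝ) + 1) ≠ 0 := by positivity
  rw [quadCoeff, smul_smul, mul_inv_cancel₀ h, one_smul,
    Finset.Nat.sum_antidiagonal_eq_sum_range_succ_mk, Finset.sum_range]

/-- The Cauchy product of order n has n + 1 terms, and the recursion divides by exactly n + 1, so a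
geometric bound reproduces itself. -/
theorem norm_quadCoeff_le (Q : E →L[ℝ] E →L[ℝ] E) (y₀ : E) (n : ℕ) :
    ‖quadCoeff Q y₀ n‖ ≤ ‖y₀‖ * (‖Q‖ * ‖y₀‖) ^ n := by
  induction n using Nat.strong_induction_on with
  | _ n ih =>
    rcases n with _ | n
    · simp [quadCoeff]
    · have h : (0 : ℝ) < (n : ℝ) + 1 := by positivity
      have h1 : ((n : ℝ) + 1) * ‖quadCoeff Q y₀ (n + 1)‖ ≤
          ((n : ℝ) + 1) * (‖y₀‖ * (‖Q‖ * ‖y₀‖) ^ (n + 1)) := by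
        have h2 : ((n : ℝ) + 1) * ‖quadCoeff Q y₀ (n + 1)‖ =
            ‖((n : ℝ) + 1) • quadCoeff Q y₀ (n + 1)‖ := by
          rw [norm_smul, Real.norm_of_nonneg h.le]
        rw [h2, quadCoeff_succ]
        refine (norm_sum_le _ _).trans ?_
        refine (Finset.sum_le_card_nsmul _ _ (‖y₀‖ * (‖Q‖ * ‖y₀‖) ^ (n + 1)) ?_).trans ?_
        · rintro ⟨i, j⟩ hij
          rw [Finset.HasAntidiagonal.mem_antidiagonal] at hij
          simp only at hij ⊢
          calc ‖Q (quadCoeff Q y₀ i) (quadCoeff Q y₀ j)‖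
              ≤ ‖Q‖ * ‖quadCoeff Q y₀ i‖ * ‖quadCoeff Q y₀ j‖ := Q.le_opNorm₂ _ _
            _ ≤ ‖Q‖ * (‖y₀‖ * (‖Q‖ * ‖y₀‖) ^ i) * (‖y₀‖ * (‖Q‖ * ‖y₀‖) ^ j) := by
              gcongr
              · exact ih i (by omega)
              · exact ih j (by omega)
            _ = ‖y₀‖ * (‖Q‖ * ‖y₀‖) ^ (n + 1) := by
              rw [← hij]; ring
        · rw [Finset.Nat.card_antidiagonal, nsmul_eq_mul]; push_cast; rfl
      exact le_of_mul_le_mul_left h1 h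

/-- Local existence of an analytic solution of `y' = Q(y, y)`. -/
theorem exists_analyticAt_quadratic_ode [CompleteSpace E] (Q : E →L[ℝ] E →L[ℝ] E) (y₀ : E) :
    ∃ z : ℝ → E, AnalyticAt ℝ z 0 ∧ z 0 = y₀ ∧
      ∀ᶠ t in 𝓝 (0 : ℝ), HasDerivAt z (Q (z t) (z t)) t := by
  set a := quadCoeff Q y₀ with ha
  set ρ : ℝ := ‖Q‖ * ‖y₀‖ with hρ
  have hρ0 : 0 ≤ ρ := by positivity
  -- Any radius with r ρ ≤ 1/2 works; the summand 1 covers ρ = 0.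
  set r : ℝ := (2 * (ρ + 1))⁻¹ with hr
  have hr0 : 0 < r := by positivity
  have hrρ : r * ρ ≤ 1 / 2 := by
    rw [hr, inv_mul_le_iff₀ (by positivity)]; linarith
  have hbd : ∀ n, ‖a n‖ ≤ ‖y₀‖ * ρ ^ n := norm_quadCoeff_le Q y₀
  have hbd' : ∀ n, r ^ n * ‖a n‖ ≤ ‖y₀‖ * (1 / 2) ^ n := fun n => by
    calc r ^ n * ‖a n‖ ≤ r ^ n * (‖y₀‖ * ρ ^ n) := by gcongr; exact hbd n
      _ = ‖y₀‖ * (r * ρ) ^ n := by rw [mul_pow]; ring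
      _ ≤ ‖y₀‖ * (1 / 2) ^ n := by gcongr
  have hsum : ∀ t : ℝ, |t| < r → Summable fun n => ‖t ^ n • a n‖ := fun t ht => by
    refine Summable.of_nonneg_of_le (fun _ => norm_nonneg _) (fun n => ?_)
      ((summable_geometric_of_lt_one (by norm_num) (by norm_num : (1 / 2 : ℝ) < 1)).mul_left ‖y₀‖)
    rw [norm_smul, norm_pow, Real.norm_eq_abs]
    refine le_trans ?_ (hbd' n)
    gcongr
  refine ⟨fun t => ∑' n, t ^ n • a n, ?_, ?_, ?_⟩
  · let P : FormalMultilinearSeries ℝ ℝ E := fun n =>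
      ContinuousMultilinearMap.mkPiRing ℝ (Fin n) (a n)
    have hrad : (r.toNNReal : ℝ≥0∞) ≤ P.radius := by
      refine P.le_radius_of_bound ‖y₀‖ fun n => ?_
      have : ‖P n‖ = ‖a n‖ := ContinuousMultilinearMap.norm_mkPiRing _
      rw [this, Real.coe_toNNReal _ hr0.le, mul_comm]
      refine (hbd' n).trans (mul_le_of_le_one_right (norm_nonneg _) ?_)
      exact pow_le_one₀ (by norm_num) (by norm_num)
    have hpos : 0 < P.radius := lt_of_lt_of_le (by simpa using hr0) hrad
    have h := (P.hasFPowerSeriesOnBall hpos).analyticAt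
    convert! h using 1
    ext t
    simp [FormalMultilinearSeries.sum, P]
  · simp only
    rw [tsum_eq_single 0 (fun n hn => by simp [hn])]
    simp [ha, quadCoeff]
  · filter_upwards [Metric.ball_mem_nhds (0 : ℝ) hr0] with t ht
    have hu : Summable fun n : ℕ => (n : ℝ) * (‖y₀‖ * (1 / 2) ^ n) * r⁻¹ := by
      have := summable_pow_mul_geometric_of_norm_lt_one 1 (r := (1 / 2 : ℝ)) (by norm_num)
      convert! (this.mul_left ‖y₀‖).mul_right r⁻¹ using 2
      ring
    have hder : HasDerivAt (fun t : ℝ => ∑' n, t ^ n • a n)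
        (∑' n : ℕ, ((n : ℝ) * t ^ (n - 1)) • a n) t := by
      refine hasDerivAt_tsum_of_isPreconnected (g := fun n t => t ^ n • a n)
        (g' := fun n t => ((n : ℝ) * t ^ (n - 1)) • a n) hu Metric.isOpen_ball
        (convex_ball (0 : ℝ) r).isPreconnected (fun n y _ => ?_) (fun n y hy => ?_)
        (Metric.mem_ball_self hr0) ?_ ht
      · exact (hasDerivAt_pow n y).smul_const (a n)
      · rcases n with _ | n
        · simp
        · have hy' : |y| < r := by simpa using hy
          rw [norm_smul, norm_mul, norm_pow, Real.norm_eq_abs y, Real.norm_of_nonneg (by positivity),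
            Nat.add_sub_cancel, mul_assoc, mul_assoc]
          refine mul_le_mul_of_nonneg_left ?_ (by positivity)
          calc |y| ^ n * ‖a (n + 1)‖ ≤ r ^ n * ‖a (n + 1)‖ := by gcongr
            _ = r ^ (n + 1) * ‖a (n + 1)‖ * r⁻¹ := by rw [pow_succ]; field_simp
            _ ≤ _ := mul_le_mul_of_nonneg_right (hbd' (n + 1)) (by positivity)
      · exact (hsum 0 (by simpa using hr0)).of_norm
    have ht' : |t| < r := by simpa using ht
    have hQ := hasSum_bilin_antidiagonal Q (hsum t ht')
    have heq : (∑' n : ℕ, ((n : ℝ) * t ^ (n - 1)) • a n) =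
        Q (∑' n, t ^ n • a n) (∑' n, t ^ n • a n) := by
      rw [← hQ.tsum_eq]
      have hfun : (fun n : ℕ => ∑ ij ∈ Finset.HasAntidiagonal.antidiagonal n, Q (t ^ ij.1 • a ij.1) (t ^ ij.2 • a ij.2))
          = fun n : ℕ => (((n + 1 : ℕ) : ℝ) * t ^ (n + 1 - 1)) • a (n + 1) := by
        ext n
        rw [Nat.add_sub_cancel, mul_comm, mul_smul]
        push_cast
        rw [ha, quadCoeff_succ, Finset.smul_sum]
        refine Finset.sum_congr rfl fun ij hij => ?_
        rw [Finset.HasAntidiagonal.mem_antidiagonal] at hij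
        simp only [map_smul, _root_.smul_apply, smul_smul, ← hij, pow_add]
        rw [mul_comm]
      rw [hfun]
      have h0 : HasSum (fun n : ℕ => (((n + 1 : ℕ) : ℝ) * t ^ (n + 1 - 1)) • a (n + 1))
          (Q (∑' n, t ^ n • a n) (∑' n, t ^ n • a n)) := hfun ▸ hQ
      -- The term n = 0 of the differentiated series has factor 0, so the truncated exponent is
      -- harmless and the index can be shifted.
      have h1 := (hasSum_nat_add_iff (f := fun n : ℕ => ((n : ℝ) * t ^ (n - 1)) • a n) 1).1 h0
      rw [h1.tsum_eq, h0.tsum_eq]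
      simp
    rw [← heq]
    exact hder

/-- Solutions of `y' = Q(y, y)` on a closed interval are analytic up to the end points. -/
theorem analyticWithinAt_of_quadratic_ode [CompleteSpace E] (Q : E →L[ℝ] E →L[ℝ] E)
    {a b s : ℝ} {y : ℝ → E} (hs : s ∈ Icc a b)
    (hy : ∀ᶠ t in 𝓝[Icc a b] s, HasDerivWithinAt y (Q (y t) (y t)) (Icc a b) t) :
    AnalyticWithinAt ℝ y (Icc a b) s := by
  obtain ⟨z, hza, hz0, hz⟩ := exists_analyticAt_quadratic_ode Q (y s)
  have hzs : AnalyticAt ℝ (fun t => z (t - s)) s := by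
    have h1 : AnalyticAt ℝ (fun t : ℝ => t - s) s := analyticAt_id.sub analyticAt_const
    have h2 : AnalyticAt ℝ z ((fun t : ℝ => t - s) s) := by simpa using hza
    exact AnalyticAt.fun_comp (g := z) (f := fun t : ℝ => t - s) h2 h1
  have hzs' : ∀ᶠ t in 𝓝 s, HasDerivAt (fun t => z (t - s)) (Q (z (t - s)) (z (t - s))) t := by
    have h1 : Tendsto (fun t : ℝ => t - s) (𝓝 s) (𝓝 0) := by
      have : Continuous fun t : ℝ => t - s := by fun_prop
      simpa using this.tendsto s
    filter_upwards [h1.eventually hz] with t ht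
    exact ht.comp_sub_const t s
  refine AnalyticWithinAt.congr_of_eventuallyEq hzs.analyticWithinAt ?_ (by simp [hz0])
  obtain ⟨δ, hδ, hδy⟩ := Metric.mem_nhdsWithin_iff.1 hy
  obtain ⟨δ', hδ', hδz⟩ := Metric.mem_nhds_iff.1 hzs'
  set d := min δ δ' / 2 with hd
  have hd0 : 0 < d := by positivity
  have hdδ : d < δ := lt_of_lt_of_le (half_lt_self (by positivity)) (min_le_left _ _)
  have hdδ' : d < δ' := lt_of_lt_of_le (half_lt_self (by positivity)) (min_le_right _ _)
  have hyd : ∀ t ∈ Icc a b, |t - s| ≤ d → HasDerivWithinAt y (Q (y t) (y t)) (Icc a b) t :=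
    fun t ht htd => hδy ⟨by rw [Metric.mem_ball, Real.dist_eq]; linarith, ht⟩
  have hzd : ∀ t, |t - s| ≤ d →
      HasDerivAt (fun t => z (t - s)) (Q (z (t - s)) (z (t - s))) t :=
    fun t htd => hδz (by rw [Metric.mem_ball, Real.dist_eq]; linarith)
  -- Clipping the window around s to [a, b] treats end points and interior points alike; one of the
  -- two halves may reduce to {s}.
  set l := max a (s - d) with hl
  set u := min b (s + d) with hu
  have hls : l ≤ s := max_le hs.1 (by linarith)
  have hsu : s ≤ u := le_min hs.2 (by linarith)
  have hsub : ∀ t ∈ Icc l u, t ∈ Icc a b ∧ |t - s| ≤ d := fun t ht => by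
    have h1 := le_max_left a (s - d)
    have h2 := le_max_right a (s - d)
    have h3 := min_le_left b (s + d)
    have h4 := min_le_right b (s + d)
    refine ⟨⟨h1.trans ht.1, ht.2.trans h3⟩, abs_le.2 ⟨?_, ?_⟩⟩
    · linarith [ht.1]
    · linarith [ht.2]
  have hyc : ContinuousOn y (Icc l u) := fun t ht =>
    ((hyd t (hsub t ht).1 (hsub t ht).2).continuousWithinAt).mono fun x hx => (hsub x hx).1
  have hzc : ContinuousOn (fun t => z (t - s)) (Icc l u) := fun t ht =>
    (hzd t (hsub t ht).2).continuousAt.continuousWithinAt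
  obtain ⟨M₁, hM₁⟩ := isCompact_Icc.exists_bound_of_continuousOn hyc
  obtain ⟨M₂, hM₂⟩ := isCompact_Icc.exists_bound_of_continuousOn hzc
  set M := max M₁ M₂
  have hM0 : 0 ≤ M := (norm_nonneg _).trans ((hM₁ s ⟨hls, hsu⟩).trans (le_max_left _ _))
  -- A quadratic field is Lipschitz only on bounded sets, so uniqueness is applied in a ball
  -- containing both solutions.
  have hLip : LipschitzOnWith (‖Q‖ * M + ‖Q‖ * M).toNNReal (fun x => Q x x)
      (Metric.closedBall (0 : E) M) := by
    refine LipschitzOnWith.of_dist_le_mul fun x hx x' hx' => ?_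
    rw [mem_closedBall_zero_iff] at hx hx'
    rw [dist_eq_norm, dist_eq_norm, Real.coe_toNNReal _ (by positivity)]
    have : Q x x - Q x' x' = Q (x - x') x + Q x' (x - x') := by
      simp
    rw [this, add_mul]
    refine (norm_add_le _ _).trans (add_le_add ?_ ?_)
    · refine (Q.le_opNorm₂ _ _).trans ?_
      rw [mul_right_comm]; gcongr
    · refine (Q.le_opNorm₂ _ _).trans ?_
      gcongr
  have hymem : ∀ t ∈ Icc l u, y t ∈ Metric.closedBall (0 : E) M := fun t ht => by
    rw [mem_closedBall_zero_iff]; exact (hM₁ t ht).trans (le_max_left _ _)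
  have hzmem : ∀ t ∈ Icc l u, z (t - s) ∈ Metric.closedBall (0 : E) M := fun t ht => by
    rw [mem_closedBall_zero_iff]; exact (hM₂ t ht).trans (le_max_right _ _)
  have hright : EqOn y (fun t => z (t - s)) (Icc s u) := by
    have hI : Icc s u ⊆ Icc l u := Icc_subset_Icc_left hls
    refine ODE_solution_unique_of_mem_Icc_right (v := fun _ x => Q x x)
      (s := fun _ => Metric.closedBall (0 : E) M) (fun _ _ => hLip) (hyc.mono hI)
      (fun t ht => ?_) (fun t ht => hymem t (hI (Ico_subset_Icc_self ht))) (hzc.mono hI)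
      (fun t ht => (hzd t (hsub t (hI (Ico_subset_Icc_self ht))).2).hasDerivWithinAt)
      (fun t ht => hzmem t (hI (Ico_subset_Icc_self ht))) (by simp [hz0])
    have h1 := hsub t (hI (Ico_subset_Icc_self ht))
    refine (hyd t h1.1 h1.2).mono_of_mem_nhdsWithin ?_
    have h2 : t < b := ht.2.trans_le (min_le_left _ _)
    filter_upwards [self_mem_nhdsWithin, nhdsWithin_le_nhds (Iio_mem_nhds h2)] with x hx hx'
    exact ⟨h1.1.1.trans hx, le_of_lt hx'⟩
  have hleft : EqOn y (fun t => z (t - s)) (Icc l s) := by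
    have hI : Icc l s ⊆ Icc l u := Icc_subset_Icc_right hsu
    refine ODE_solution_unique_of_mem_Icc_left (v := fun _ x => Q x x)
      (s := fun _ => Metric.closedBall (0 : E) M) (fun _ _ => hLip) (hyc.mono hI)
      (fun t ht => ?_) (fun t ht => hymem t (hI (Ioc_subset_Icc_self ht))) (hzc.mono hI)
      (fun t ht => (hzd t (hsub t (hI (Ioc_subset_Icc_self ht))).2).hasDerivWithinAt)
      (fun t ht => hzmem t (hI (Ioc_subset_Icc_self ht))) (by simp [hz0])
    have h1 := hsub t (hI (Ioc_subset_Icc_self ht))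
    refine (hyd t h1.1 h1.2).mono_of_mem_nhdsWithin ?_
    have h2 : a < t := (le_max_left _ _).trans_lt ht.1
    filter_upwards [self_mem_nhdsWithin, nhdsWithin_le_nhds (Ioi_mem_nhds h2)] with x hx hx'
    exact ⟨le_of_lt hx', le_trans hx h1.1.2⟩
  filter_upwards [self_mem_nhdsWithin, nhdsWithin_le_nhds (Metric.ball_mem_nhds s hd0)] with t ht htd
  rw [Metric.mem_ball, Real.dist_eq, abs_lt] at htd
  rcases le_total s t with h | h
  · exact hright ⟨h, le_min ht.2 (by linarith)⟩
  · exact hleft ⟨max_le ht.1 (by linarith), h⟩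

end QuadraticODE

/-! ### Signed powers. -/

section SignedPower

/-- The signed power `sgn(x) |x|^α`. -/
noncomputable def spow (α x : ℝ) : ℝ := x * |x| ^ (α - 1)

@[simp] theorem spow_zero (α : ℝ) : spow α 0 = 0 := by simp [spow]

theorem spow_one (x : ℝ) : spow 1 x = x := by simp [spow]

theorem abs_spow {α : ℝ} (hα : 0 < α) (x : ℝ) : |spow α x| = |x| ^ α := by
  rcases eq_or_ne x 0 with rfl | hx
  · simp [Real.zero_rpow hα.ne']
  · have h : 0 < |x| := abs_pos.2 hx
    rw [spow, abs_mul, abs_of_nonneg (Real.rpow_nonneg h.le _), Real.rpow_sub_one h.ne']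
    field_simp

/-- With β α = 1 this recovers the curvature from w. -/
theorem spow_spow {α β : ℝ} (hβ : 0 < β) (x : ℝ) : spow α (spow β x) = spow (β * α) x := by
  rcases eq_or_ne x 0 with rfl | hx
  · simp
  · have h : 0 < |x| := abs_pos.2 hx
    rw [spow, abs_spow hβ, ← Real.rpow_mul h.le, spow, spow, mul_assoc, ← Real.rpow_add h]
    congr 2
    ring

theorem spow_ne_zero {α : ℝ} {x : ℝ} (hx : x ≠ 0) : spow α x ≠ 0 :=
  mul_ne_zero hx (Real.rpow_pos_of_pos (abs_pos.2 hx) _).ne'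

theorem spow_eq_zero_iff {α : ℝ} {x : ℝ} : spow α x = 0 ↔ x = 0 :=
  ⟨fun h => by_contra fun hx => spow_ne_zero hx h, fun h => by simp [h]⟩

theorem hasDerivAt_abs_rpow_of_ne_zero (α : ℝ) {x : ℝ} (hx : x ≠ 0) :
    HasDerivAt (fun x : ℝ => |x| ^ α) (α * |x| ^ α / x) x := by
  have h : 0 < |x| := abs_pos.2 hx
  have h1 := (hasDerivAt_abs hx).rpow_const (p := α) (Or.inl h.ne')
  convert! h1 using 1
  rw [Real.rpow_sub_one h.ne']
  rcases lt_or_gt_of_ne hx with hx' | hx'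
  · rw [abs_of_neg hx', sign_neg hx']; simp; field_simp
  · rw [abs_of_pos hx', sign_pos hx']; simp; field_simp

theorem hasDerivAt_spow (α : ℝ) {x : ℝ} (hx : x ≠ 0) :
    HasDerivAt (spow α) (α * |x| ^ (α - 1)) x := by
  have h1 := (hasDerivAt_id x).mul (hasDerivAt_abs_rpow_of_ne_zero (α - 1) hx)
  convert! h1 using 1
  simp
  field_simp
  ring

theorem continuous_spow {α : ℝ} (hα : 0 < α) : Continuous (spow α) := by
  rw [continuous_iff_continuousAt]
  intro x
  rcases eq_or_ne x 0 with rfl | hx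
  · rw [ContinuousAt, spow_zero, tendsto_zero_iff_norm_tendsto_zero]
    have h : Continuous fun x : ℝ => |x| ^ α := continuous_abs.rpow_const fun _ => Or.inr hα.le
    have h1 := h.tendsto 0
    simp only [abs_zero, Real.zero_rpow hα.ne'] at h1
    refine h1.congr fun y => ?_
    rw [Real.norm_eq_abs, abs_spow hα]
  · exact (hasDerivAt_spow α hx).continuousAt

end SignedPower

/-! ### The fundamental theorem of calculus for signed powers. -/

section Primitive

/-- The fundamental theorem of calculus holds for `f` and `f'` between `x` and `y`. -/
def IsPrimitive (f f' : ℝ → ℝ) (x y : ℝ) : Prop :=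
  IntervalIntegrable f' volume x y ∧ ∫ t in x..y, f' t = f y - f x

theorem IsPrimitive.symm {f f' : ℝ → ℝ} {x y : ℝ} (h : IsPrimitive f f' x y) :
    IsPrimitive f f' y x :=
  ⟨h.1.symm, by rw [intervalIntegral.integral_symm, h.2]; ring⟩

theorem IsPrimitive.trans {f f' : ℝ → ℝ} {x y z : ℝ} (h : IsPrimitive f f' x y)
    (h' : IsPrimitive f f' y z) : IsPrimitive f f' x z :=
  ⟨h.1.trans h'.1, by
    rw [← intervalIntegral.integral_add_adjacent_intervals h.1 h'.1, h.2, h'.2]; ring⟩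

theorem isPrimitive_of_eq_zero {f f' : ℝ → ℝ} {x y : ℝ} (hf : ∀ t ∈ uIcc x y, f t = 0)
    (hf' : ∀ t ∈ uIcc x y, f' t = 0) : IsPrimitive f f' x y := by
  have h : EqOn (fun _ => (0 : ℝ)) f' (uIcc x y) := fun t ht => (hf' t ht).symm
  refine ⟨(intervalIntegrable_const (c := (0 : ℝ))).congr (fun t ht => ?_), ?_⟩
  · exact h (uIoc_subset_uIcc ht)
  · rw [← intervalIntegral.integral_congr h, hf y right_mem_uIcc, hf x left_mem_uIcc]
    simp

/-- Integrability is not assumed: a nonnegative derivative of a continuous function is automatically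
integrable. This admits derivatives that blow up at the end points. -/
theorem isPrimitive_of_nonneg {f f' : ℝ → ℝ} {a b : ℝ} (hab : a ≤ b)
    (hc : ContinuousOn f (Icc a b)) (hd : ∀ t ∈ Ioo a b, HasDerivAt f (f' t) t)
    (hpos : ∀ t ∈ Ioo a b, 0 ≤ f' t) : IsPrimitive f f' a b := by
  have h : IntervalIntegrable f' volume a b := by
    apply intervalIntegral.intervalIntegrable_deriv_of_nonneg (g := f)
    · rwa [uIcc_of_le hab]
    · rwa [min_eq_left hab, max_eq_right hab]
    · rwa [min_eq_left hab, max_eq_right hab]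
  exact ⟨h, intervalIntegral.integral_eq_sub_of_hasDerivAt_of_le hab hc hd h⟩

theorem isPrimitive_of_nonpos {f f' : ℝ → ℝ} {a b : ℝ} (hab : a ≤ b)
    (hc : ContinuousOn f (Icc a b)) (hd : ∀ t ∈ Ioo a b, HasDerivAt f (f' t) t)
    (hneg : ∀ t ∈ Ioo a b, f' t ≤ 0) : IsPrimitive f f' a b := by
  have h := isPrimitive_of_nonneg (f := -f) (f' := -f') hab hc.neg (fun t ht => (hd t ht).neg)
    (fun t ht => neg_nonneg.2 (hneg t ht))
  refine ⟨by simpa using h.1.neg, ?_⟩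
  have := h.2
  simp only [Pi.neg_apply, intervalIntegral.integral_neg] at this
  linarith

theorem IsPrimitive.of_comp_neg {f f' : ℝ → ℝ} {x y : ℝ}
    (h : IsPrimitive (fun t => f (-t)) (fun t => -f' (-t)) x y) :
    IsPrimitive f f' (-x) (-y) := by
  have h1 : IntervalIntegrable (fun t => f' (-t)) volume x y := by
    have h2 := h.1.neg
    convert! h2 using 1
    ext t
    simp
  refine ⟨?_, ?_⟩
  · have := (IntervalIntegrable.iff_comp_neg (f := f') (a := -x) (b := -y)).2
    apply this
    simpa using h1
  · have h2 := h.2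
    rw [intervalIntegral.integral_neg, intervalIntegral.integral_comp_neg] at h2
    rw [intervalIntegral.integral_symm]
    exact h2

theorem IsPrimitive.absolutelyContinuousOnInterval {f f' : ℝ → ℝ} {a b : ℝ} (hab : a ≤ b)
    (h : ∀ t ∈ Icc a b, IsPrimitive f f' a t) : AbsolutelyContinuousOnInterval f a b := by
  have h1 := ((h b (right_mem_Icc.2 hab)).1.absolutelyContinuousOnInterval_intervalIntegral
    (c := a) left_mem_uIcc)
  have h2 : AbsolutelyContinuousOnInterval (fun _ : ℝ => f a) a b :=
    (LipschitzWith.const (f a)).lipschitzOnWith.absolutelyContinuousOnInterval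
  have h3 := h1.add h2
  rw [absolutelyContinuousOnInterval_iff] at h3 ⊢
  intro ε hε
  obtain ⟨δ, hδ, hI⟩ := h3 ε hε
  refine ⟨δ, hδ, fun E hE hEδ => ?_⟩
  have := hI E hE hEδ
  convert! this using 1
  refine Finset.sum_congr rfl fun i hi => ?_
  have hm := hE.1 i hi
  rw [uIcc_of_le hab] at hm
  simp only [Pi.add_apply, (h _ hm.1).2, (h _ hm.2).2, sub_add_cancel]

/-- The derivative of `spow α ∘ w` where `w ≠ 0`, extended by zero. -/
noncomputable def spowDeriv (α : ℝ) (w w' : ℝ → ℝ) (t : ℝ) : ℝ :=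
  if w t = 0 then 0 else α * |w t| ^ (α - 1) * w' t

theorem hasDerivAt_spow_comp (α : ℝ) {w w' : ℝ → ℝ} {t : ℝ} (hw : HasDerivAt w (w' t) t)
    (ht : w t ≠ 0) : HasDerivAt (fun t => spow α (w t)) (spowDeriv α w w' t) t := by
  rw [spowDeriv, if_neg ht]
  exact (hasDerivAt_spow α ht).comp t hw

/-- If `|w|` grows away from a zero `a` of `w`, then `spow α ∘ w` is the integral of its
derivative. -/
theorem isPrimitive_spow_right {α : ℝ} (hα : 0 < α) {w w' : ℝ → ℝ} {a b : ℝ} (hab : a ≤ b)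
    (hc : ContinuousOn w (Icc a b)) (hd : ∀ t ∈ Ioo a b, HasDerivAt w (w' t) t)
    (ha : w a = 0) (hq : ∀ t ∈ Ioo a b, 0 ≤ w t * w' t) :
    IsPrimitive (fun t => spow α (w t)) (spowDeriv α w w') a b := by
  -- Since w² is monotone and vanishes at a, its zero set is an interval [a, z]. Beyond z the
  -- function w keeps one sign, so `spow α ∘ w` is monotone there.
  have hmono : MonotoneOn (fun t => w t ^ 2) (Icc a b) := by
    have hd2 : ∀ t ∈ Ioo a b, HasDerivAt (fun t => w t ^ 2) (2 * (w t * w' t)) t := fun t ht => by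
      have := (hd t ht).pow 2
      convert! this using 1
      simp; ring
    refine monotoneOn_of_deriv_nonneg (convex_Icc a b) (hc.pow 2) ?_ ?_
    · rw [interior_Icc]
      exact fun t ht => (hd2 t ht).differentiableAt.differentiableWithinAt
    · rw [interior_Icc]
      intro t ht
      rw [(hd2 t ht).deriv]
      have := hq t ht
      positivity
  set S : Set ℝ := {s | s ∈ Icc a b ∧ w s = 0} with hS
  have hScl : IsClosed S := by
    have : S = Icc a b ∩ w ⁻¹' {0} := by ext; simp [hS]
    rw [this]
    exact hc.preimage_isClosed_of_isClosed isClosed_Icc isClosed_singleton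
  have hScpt : IsCompact S := isCompact_Icc.of_isClosed_subset hScl fun s hs => hs.1
  have hSne : S.Nonempty := ⟨a, left_mem_Icc.2 hab, ha⟩
  set z := sSup S with hz
  have hzS : z ∈ S := hScpt.sSup_mem hSne
  have hzmax : ∀ t ∈ Ioc z b, w t ≠ 0 := fun t ht h0 => by
    have : t ≤ z := le_csSup hScpt.bddAbove ⟨⟨hzS.1.1.trans ht.1.le, ht.2⟩, h0⟩
    exact absurd ht.1 (not_lt.2 this)
  have hzero : ∀ t ∈ Icc a z, w t = 0 := fun t ht => by
    have := hmono ⟨ht.1, ht.2.trans hzS.1.2⟩ hzS.1 ht.2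
    simp only [hzS.2] at this
    have h0 : w t ^ 2 = 0 := le_antisymm (by simpa using this) (sq_nonneg _)
    exact pow_eq_zero_iff two_ne_zero |>.1 h0
  have h1 : IsPrimitive (fun t => spow α (w t)) (spowDeriv α w w') a z := by
    refine isPrimitive_of_eq_zero (fun t ht => ?_) (fun t ht => ?_) <;>
      rw [uIcc_of_le hzS.1.1] at ht
    · simp [hzero t ht]
    · simp [spowDeriv, hzero t ht]
  refine h1.trans ?_
  have hkc : ContinuousOn (fun t => spow α (w t)) (Icc z b) :=
    (continuous_spow hα).comp_continuousOn (hc.mono (Icc_subset_Icc_left hzS.1.1))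
  have hsub : Ioo z b ⊆ Ioo a b := Ioo_subset_Ioo_left hzS.1.1
  have hkd : ∀ t ∈ Ioo z b, HasDerivAt (fun t => spow α (w t)) (spowDeriv α w w' t) t :=
    fun t ht => hasDerivAt_spow_comp α (hd t (hsub ht)) (hzmax t (Ioo_subset_Ioc_self ht))
  have hsign : (∀ t ∈ Ioo z b, 0 < w t) ∨ (∀ t ∈ Ioo z b, w t < 0) := by
    by_contra! h
    obtain ⟨⟨x, hx, hx0⟩, y, hy, hy0⟩ := h
    obtain ⟨t, ht, ht0⟩ := (isPreconnected_Ioo (a := z) (b := b)).intermediate_value hx hy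
      (hc.mono (hsub.trans Ioo_subset_Icc_self)) ⟨hx0, hy0⟩
    exact hzmax t (Ioo_subset_Ioc_self ht) ht0
  rcases hsign with h | h
  · refine isPrimitive_of_nonneg hzS.1.2 hkc hkd fun t ht => ?_
    rw [spowDeriv, if_neg (h t ht).ne']
    have : 0 ≤ w' t := nonneg_of_mul_nonneg_right (hq t (hsub ht)) (h t ht)
    positivity
  · refine isPrimitive_of_nonpos hzS.1.2 hkc hkd fun t ht => ?_
    rw [spowDeriv, if_neg (h t ht).ne]
    have : w' t ≤ 0 := by
      by_contra! h'
      have := hq t (hsub ht)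
      nlinarith [h t ht]
    exact mul_nonpos_of_nonneg_of_nonpos (by positivity) this

/-- The mirror image of `isPrimitive_spow_right` under t ↦ -t. -/
theorem isPrimitive_spow_left {α : ℝ} (hα : 0 < α) {w w' : ℝ → ℝ} {a b : ℝ} (hab : a ≤ b)
    (hc : ContinuousOn w (Icc a b)) (hd : ∀ t ∈ Ioo a b, HasDerivAt w (w' t) t)
    (hb : w b = 0) (hq : ∀ t ∈ Ioo a b, w t * w' t ≤ 0) :
    IsPrimitive (fun t => spow α (w t)) (spowDeriv α w w') a b := by
  have h := isPrimitive_spow_right hα (w := fun t => w (-t)) (w' := fun t => -w' (-t))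
    (a := -b) (b := -a) (neg_le_neg hab)
    (hc.comp continuous_neg.continuousOn fun t ht => ⟨by linarith [ht.2], by linarith [ht.1]⟩)
    (fun t ht => by
      have h1 := hd (-t) ⟨by linarith [ht.2], by linarith [ht.1]⟩
      have h2 := h1.comp t (hasDerivAt_neg t)
      rw [mul_neg_one] at h2
      exact h2)
    (by simpa using hb)
    (fun t ht => by
      have h1 := hq (-t) ⟨by linarith [ht.2], by linarith [ht.1]⟩
      nlinarith)
  have h2 : IsPrimitive (fun t => spow α (w t)) (spowDeriv α w w') (- -b) (- -a) := by
    refine IsPrimitive.of_comp_neg ?_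
    convert! h using 1
    ext t
    by_cases h0 : w (-t) = 0 <;> simp [spowDeriv, h0]
  simpa using h2.symm

end Primitive

/-! ### The first-order system and absolute continuity of the curvature. -/

/-- The first-order form, in the arclength parameter, of the equation of a `p`-elastica: `(T₀, T₁)`
is the unit tangent of `γ`, the curvature is `spow (p - 1)⁻¹ w`, and `(C₀, C₁)` is the constant
vector which is conserved because of translation invariance. -/
structure IsElasticaFrame (p lam C₀ C₁ L : ℝ) (γ : ℝ → Plane) (T₀ T₁ w : ℝ → ℝ) : Prop where
  deriv_fst : ∀ s ∈ Icc 0 L, HasDerivWithinAt (fun s => γ s 0) (T₀ s) (Icc 0 L) s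
  deriv_snd : ∀ s ∈ Icc 0 L, HasDerivWithinAt (fun s => γ s 1) (T₁ s) (Icc 0 L) s
  deriv_T₀ : ∀ s ∈ Icc 0 L,
    HasDerivWithinAt T₀ (-(spow (p - 1)⁻¹ (w s) * T₁ s)) (Icc 0 L) s
  deriv_T₁ : ∀ s ∈ Icc 0 L, HasDerivWithinAt T₁ (spow (p - 1)⁻¹ (w s) * T₀ s) (Icc 0 L) s
  deriv_w : ∀ s ∈ Icc 0 L, HasDerivWithinAt w ((C₁ * T₀ s - C₀ * T₁ s) / p) (Icc 0 L) s
  unit : ∀ s ∈ Icc 0 L, T₀ s ^ 2 + T₁ s ^ 2 = 1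
  tangential : ∀ s ∈ Icc 0 L,
    (1 - p) * |spow (p - 1)⁻¹ (w s)| ^ p + lam + C₀ * T₀ s + C₁ * T₁ s = 0

namespace IsElasticaFrame

variable {p lam C₀ C₁ L : ℝ} {γ : ℝ → Plane} {T₀ T₁ w : ℝ → ℝ}

theorem continuousOn_w (h : IsElasticaFrame p lam C₀ C₁ L γ T₀ T₁ w) :
    ContinuousOn w (Icc 0 L) := fun s hs => (h.deriv_w s hs).continuousWithinAt

theorem continuousOn_T₀ (h : IsElasticaFrame p lam C₀ C₁ L γ T₀ T₁ w) :
    ContinuousOn T₀ (Icc 0 L) := fun s hs => (h.deriv_T₀ s hs).continuousWithinAt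

theorem continuousOn_T₁ (h : IsElasticaFrame p lam C₀ C₁ L γ T₀ T₁ w) :
    ContinuousOn T₁ (Icc 0 L) := fun s hs => (h.deriv_T₁ s hs).continuousWithinAt

theorem continuousOn_curvature (hp : 1 < p) (h : IsElasticaFrame p lam C₀ C₁ L γ T₀ T₁ w) :
    ContinuousOn (fun s => spow (p - 1)⁻¹ (w s)) (Icc 0 L) :=
  (continuous_spow (inv_pos.2 (sub_pos.2 hp))).comp_continuousOn h.continuousOn_w

/-- The first integral of the curvature equation. -/
theorem energy (hp : 1 < p) (h : IsElasticaFrame p lam C₀ C₁ L γ T₀ T₁ w) {s : ℝ}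
    (hs : s ∈ Icc 0 L) :
    (p * ((C₁ * T₀ s - C₀ * T₁ s) / p)) ^ 2 +
      ((p - 1) * |spow (p - 1)⁻¹ (w s)| ^ p - lam) ^ 2 = C₀ ^ 2 + C₁ ^ 2 := by
  have h1 := h.tangential s hs
  have h2 : (p - 1) * |spow (p - 1)⁻¹ (w s)| ^ p - lam = C₀ * T₀ s + C₁ * T₁ s := by linarith
  rw [h2, mul_div_cancel₀ _ (by linarith : p ≠ 0)]
  -- Pythagoras for C in the orthonormal frame (T, N).
  linear_combination (C₀ ^ 2 + C₁ ^ 2) * h.unit s hs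

/-- Near a zero of `w` the product `w w'` is nondecreasing. -/
theorem eventually_deriv_mul_nonneg (hp : 1 < p) (h : IsElasticaFrame p lam C₀ C₁ L γ T₀ T₁ w)
    {s : ℝ} (hs : s ∈ Icc 0 L) (hws : w s = 0) :
    ∀ᶠ t in 𝓝[Icc 0 L] s, 0 ≤ ((C₁ * T₀ t - C₀ * T₁ t) / p) ^ 2 +
      w t * (spow (p - 1)⁻¹ (w t) * (lam - (p - 1) * |spow (p - 1)⁻¹ (w t)| ^ p) / p) := by
  have hα : 0 < (p - 1)⁻¹ := inv_pos.2 (sub_pos.2 hp)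
  have hp0 : 0 < p := by linarith
  have hwk : ∀ t, 0 ≤ w t * spow (p - 1)⁻¹ (w t) := fun t => by
    rw [spow, ← mul_assoc]
    exact mul_nonneg (mul_self_nonneg _) (Real.rpow_nonneg (abs_nonneg _) _)
  have hcont : ContinuousOn (fun t => |spow (p - 1)⁻¹ (w t)| ^ p) (Icc 0 L) :=
    (h.continuousOn_curvature hp).abs.rpow_const fun _ _ => Or.inr hp0.le
  have hcont' : ContinuousOn (fun t => (p - 1) * |spow (p - 1)⁻¹ (w t)| ^ p) (Icc 0 L) :=
    continuousOn_const.mul hcont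
  have hs0 : (p - 1) * |spow (p - 1)⁻¹ (w s)| ^ p = 0 := by
    rw [hws, spow_zero, abs_zero, Real.zero_rpow hp0.ne', mul_zero]
  rcases lt_or_ge 0 lam with hlam | hlam
  -- For lam > 0 the term w w'' is itself nonnegative as long as the curvature is small.
  · have hev : ∀ᶠ t in 𝓝[Icc 0 L] s, (p - 1) * |spow (p - 1)⁻¹ (w t)| ^ p < lam :=
      (hcont' s hs).eventually (gt_mem_nhds (hs0.trans_lt hlam))
    filter_upwards [hev] with t ht
    have h1 := hwk t
    have h2 : w t * (spow (p - 1)⁻¹ (w t) * (lam - (p - 1) * |spow (p - 1)⁻¹ (w t)| ^ p) / p) =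
        (w t * spow (p - 1)⁻¹ (w t)) * (lam - (p - 1) * |spow (p - 1)⁻¹ (w t)| ^ p) / p := by ring
    rw [h2]
    have h3 : 0 < lam - (p - 1) * |spow (p - 1)⁻¹ (w t)| ^ p := by linarith
    positivity
  · by_cases hd : C₁ * T₀ s - C₀ * T₁ s = 0
    -- At a zero of both w and w' the first integral gives lam² = |C|². Comparing with any t, every
    -- term of (p w')² + ((p - 1)|k|^p)² - 2 lam (p - 1)|k|^p = 0 is nonnegative because lam ≤ 0. So
    -- k vanishes identically.
    · have hC := h.energy hp hs
      rw [hd, hs0, zero_div, mul_zero] at hC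
      filter_upwards [self_mem_nhdsWithin] with t ht
      have hE := h.energy hp ht
      rw [← hC] at hE
      set X := |spow (p - 1)⁻¹ (w t)| ^ p with hX
      have hX0 : 0 ≤ X := Real.rpow_nonneg (abs_nonneg _) _
      have hX1 : X = 0 := by
        have h1 : ((p - 1) * X) ^ 2 ≤ 0 := by
          have h2 : 0 ≤ -lam * ((p - 1) * X) :=
            mul_nonneg (by linarith) (mul_nonneg (by linarith) hX0)
          nlinarith [sq_nonneg (p * ((C₁ * T₀ t - C₀ * T₁ t) / p))]
        have h3 : (p - 1) * X = 0 := pow_eq_zero_iff two_ne_zero |>.1 (le_antisymm h1 (sq_nonneg _))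
        rcases mul_eq_zero.1 h3 with h4 | h4
        · linarith
        · exact h4
      have hk : spow (p - 1)⁻¹ (w t) = 0 := by
        rw [hX, Real.rpow_eq_zero (abs_nonneg _) hp0.ne'] at hX1
        exact abs_eq_zero.1 hX1
      rw [hk]
      simp only [zero_mul, zero_div, mul_zero, add_zero]
      positivity
    -- At a simple zero the square w'² is positive and dominates by continuity.
    · have hcw : ContinuousOn (fun t => ((C₁ * T₀ t - C₀ * T₁ t) / p) ^ 2 +
          w t * (spow (p - 1)⁻¹ (w t) * (lam - (p - 1) * |spow (p - 1)⁻¹ (w t)| ^ p) / p))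
          (Icc 0 L) := by
        have h1 := h.continuousOn_T₀
        have h2 := h.continuousOn_T₁
        have h3 := h.continuousOn_w
        have h4 := h.continuousOn_curvature hp
        fun_prop
      have hpos : 0 < ((C₁ * T₀ s - C₀ * T₁ s) / p) ^ 2 +
          w s * (spow (p - 1)⁻¹ (w s) * (lam - (p - 1) * |spow (p - 1)⁻¹ (w s)| ^ p) / p) := by
        rw [hws, zero_mul, add_zero]
        positivity
      filter_upwards [(hcw s hs).eventually (lt_mem_nhds hpos)] with t ht
      exact ht.le

/-- Differentiating p w' = C·N gives p w'' = -k (C·T), and the tangential identity eliminates C·T.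
-/
theorem hasDerivWithinAt_mul_deriv (h : IsElasticaFrame p lam C₀ C₁ L γ T₀ T₁ w)
    {t : ℝ} (ht : t ∈ Icc 0 L) :
    HasDerivWithinAt (fun t => w t * ((C₁ * T₀ t - C₀ * T₁ t) / p))
      (((C₁ * T₀ t - C₀ * T₁ t) / p) ^ 2 +
      w t * (spow (p - 1)⁻¹ (w t) * (lam - (p - 1) * |spow (p - 1)⁻¹ (w t)| ^ p) / p))
      (Icc 0 L) t := by
  have h1 := (h.deriv_w t ht).mul
    ((((h.deriv_T₀ t ht).const_mul C₁).sub ((h.deriv_T₁ t ht).const_mul C₀)).div_const p)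
  convert! h1 using 1
  have h2 := h.tangential t ht
  have h3 : lam - (p - 1) * |spow (p - 1)⁻¹ (w t)| ^ p = -(C₀ * T₀ t + C₁ * T₁ t) := by linarith
  rw [h3]
  simp
  ring

/-- At a zero s of w the product w w' vanishes and is nondecreasing nearby, hence is ≤ 0 on the left
and ≥ 0 on the right: the sign conditions of the one-sided lemmas. Away from zeros the signed power
is smooth. -/
theorem eventually_isPrimitive (hp : 1 < p) (h : IsElasticaFrame p lam C₀ C₁ L γ T₀ T₁ w)
    {s : ℝ} (hs : s ∈ Icc 0 L) :
    ∀ᶠ t in 𝓝[Icc 0 L] s, IsPrimitive (fun t => spow (p - 1)⁻¹ (w t))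
      (spowDeriv (p - 1)⁻¹ w fun t => (C₁ * T₀ t - C₀ * T₁ t) / p) s t := by
  have hα : 0 < (p - 1)⁻¹ := inv_pos.2 (sub_pos.2 hp)
  have hw' : ContinuousOn (fun t => (C₁ * T₀ t - C₀ * T₁ t) / p) (Icc 0 L) := by
    have h1 := h.continuousOn_T₀
    have h2 := h.continuousOn_T₁
    fun_prop
  have hint : ∀ {x y : ℝ}, x ∈ Icc 0 L → y ∈ Icc 0 L → ∀ t ∈ Ioo x y,
      HasDerivAt w ((C₁ * T₀ t - C₀ * T₁ t) / p) t := fun hx hy t ht =>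
    (h.deriv_w t ⟨hx.1.trans ht.1.le, ht.2.le.trans hy.2⟩).hasDerivAt
      (Icc_mem_nhds (hx.1.trans_lt ht.1) (ht.2.trans_le hy.2))
  by_cases hws : w s = 0
  · obtain ⟨δ, hδ, hδs⟩ := Metric.mem_nhdsWithin_iff.1 (h.eventually_deriv_mul_nonneg hp hs hws)
    have hmono : ∀ {x y : ℝ}, x ≤ y → x ∈ Icc 0 L → y ∈ Icc 0 L → |x - s| < δ → |y - s| < δ →
        MonotoneOn (fun t => w t * ((C₁ * T₀ t - C₀ * T₁ t) / p)) (Icc x y) := by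
      intro x y hxy hx hy hxδ hyδ
      have hsub : Icc x y ⊆ Icc 0 L := Icc_subset_Icc hx.1 hy.2
      have hd : ∀ t ∈ Ioo x y, HasDerivAt (fun t => w t * ((C₁ * T₀ t - C₀ * T₁ t) / p)) _ t :=
        fun t ht => (h.hasDerivWithinAt_mul_deriv (hsub (Ioo_subset_Icc_self ht))).hasDerivAt
          (Icc_mem_nhds (hx.1.trans_lt ht.1) (ht.2.trans_le hy.2))
      refine monotoneOn_of_deriv_nonneg (convex_Icc x y)
        ((h.continuousOn_w.mul hw').mono hsub) ?_ ?_
      · rw [interior_Icc]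
        exact fun t ht => (hd t ht).differentiableAt.differentiableWithinAt
      · rw [interior_Icc]
        intro t ht
        rw [(hd t ht).deriv]
        refine hδs ⟨?_, hsub (Ioo_subset_Icc_self ht)⟩
        rw [Metric.mem_ball, Real.dist_eq]
        rw [abs_lt] at hxδ hyδ ⊢
        constructor <;> linarith [ht.1, ht.2]
    have hss : |s - s| < δ := by simpa using hδ
    filter_upwards [self_mem_nhdsWithin, nhdsWithin_le_nhds (Metric.ball_mem_nhds s hδ)]
      with t ht htδ
    rw [Metric.mem_ball, Real.dist_eq] at htδ
    rcases le_total s t with hst | hst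
    · refine isPrimitive_spow_right hα hst
        (h.continuousOn_w.mono (Icc_subset_Icc hs.1 ht.2)) (hint hs ht) hws fun x hx => ?_
      have := hmono hst hs ht hss htδ (left_mem_Icc.2 hst) (Ioo_subset_Icc_self hx) hx.1.le
      simpa [hws] using this
    · refine (isPrimitive_spow_left hα hst
        (h.continuousOn_w.mono (Icc_subset_Icc ht.1 hs.2)) (hint ht hs) hws fun x hx => ?_).symm
      have := hmono hst ht hs htδ hss (Ioo_subset_Icc_self hx) (right_mem_Icc.2 hst) hx.2.le
      simpa [hws] using this
  · obtain ⟨δ, hδ, hδs⟩ := Metric.mem_nhdsWithin_iff.1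
      ((h.continuousOn_w s hs).eventually_ne hws)
    have key : ∀ {x y : ℝ}, x ≤ y → x ∈ Icc 0 L → y ∈ Icc 0 L → |x - s| < δ → |y - s| < δ →
        IsPrimitive (fun t => spow (p - 1)⁻¹ (w t))
          (spowDeriv (p - 1)⁻¹ w fun t => (C₁ * T₀ t - C₀ * T₁ t) / p) x y := by
      intro x y hxy hx hy hxδ hyδ
      have hsub : Icc x y ⊆ Icc 0 L := Icc_subset_Icc hx.1 hy.2
      have hne : ∀ t ∈ Icc x y, w t ≠ 0 := fun t ht => by
        refine hδs ⟨?_, hsub ht⟩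
        rw [Metric.mem_ball, Real.dist_eq]
        rw [abs_lt] at hxδ hyδ ⊢
        constructor <;> linarith [ht.1, ht.2]
      have hk' : ContinuousOn (spowDeriv (p - 1)⁻¹ w fun t => (C₁ * T₀ t - C₀ * T₁ t) / p)
          (Icc x y) := by
        have h1 : ContinuousOn (fun t => (p - 1)⁻¹ * |w t| ^ ((p - 1)⁻¹ - 1) *
            ((C₁ * T₀ t - C₀ * T₁ t) / p)) (Icc x y) :=
          (continuousOn_const.mul ((h.continuousOn_w.mono hsub).abs.rpow_const
            fun t ht => Or.inl (abs_pos.2 (hne t ht)).ne')).mul (hw'.mono hsub)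
        refine h1.congr fun t ht => ?_
        rw [spowDeriv, if_neg (hne t ht)]
      have hi := hk'.intervalIntegrable_of_Icc (μ := volume) hxy
      exact ⟨hi, intervalIntegral.integral_eq_sub_of_hasDerivAt_of_le hxy
        ((h.continuousOn_curvature hp).mono hsub)
        (fun t ht => hasDerivAt_spow_comp (w' := fun t => (C₁ * T₀ t - C₀ * T₁ t) / p) _
          (hint hx hy t ht) (hne t (Ioo_subset_Icc_self ht))) hi⟩
    have hss : |s - s| < δ := by simpa using hδ
    filter_upwards [self_mem_nhdsWithin, nhdsWithin_le_nhds (Metric.ball_mem_nhds s hδ)]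
      with t ht htδ
    rw [Metric.mem_ball, Real.dist_eq] at htδ
    rcases le_total s t with hst | hst
    · exact key hst hs ht hss htδ
    · exact (key hst ht hs htδ hss).symm

/-- `IsPrimitive` is symmetric and transitive in its end points, so its local validity spreads over
the connected interval. -/
theorem absolutelyContinuous_curvature (hp : 1 < p) (hL : 0 ≤ L)
    (h : IsElasticaFrame p lam C₀ C₁ L γ T₀ T₁ w) :
    AbsolutelyContinuousOnInterval (fun t => spow (p - 1)⁻¹ (w t)) 0 L := by
  refine IsPrimitive.absolutelyContinuousOnInterval hL
    (f' := spowDeriv (p - 1)⁻¹ w fun t => (C₁ * T₀ t - C₀ * T₁ t) / p) fun t ht => ?_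
  exact isPreconnected_Icc.induction₂ (s := Icc 0 L)
    (IsPrimitive (fun t => spow (p - 1)⁻¹ (w t))
      (spowDeriv (p - 1)⁻¹ w fun t => (C₁ * T₀ t - C₀ * T₁ t) / p))
    (fun x hx => h.eventually_isPrimitive hp hx) (fun _ _ _ _ _ _ h1 h2 => h1.trans h2)
    (fun _ _ _ _ h1 => h1.symm) (left_mem_Icc.2 hL) ht

end IsElasticaFrame

/-! ### Weak derivatives of absolutely continuous functions. -/

section WeakDerivative

theorem IsTestFunction.eq_zero_of_notMem {F : Type*} [NormedAddCommGroup F] [NormedSpace ℝ F]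
    {a b : ℝ} {φ : ℝ → F} (h : IsTestFunction a b φ) {t : ℝ} (ht : t ∉ Ioo a b) : φ t = 0 :=
  image_eq_zero_of_notMem_tsupport fun h' => ht (h.2.2 h')

theorem IsTestFunction.differentiable {F : Type*} [NormedAddCommGroup F] [NormedSpace ℝ F]
    {a b : ℝ} {φ : ℝ → F} (h : IsTestFunction a b φ) : Differentiable ℝ φ :=
  h.1.differentiable (by simp)

theorem IsTestFunction.deriv {F : Type*} [NormedAddCommGroup F] [NormedSpace ℝ F]
    {a b : ℝ} {φ : ℝ → F} (h : IsTestFunction a b φ) : IsTestFunction a b (deriv φ) :=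
  ⟨((contDiff_infty_iff_deriv (𝕜 := ℝ)).1 h.1).2, h.2.1.deriv,
    tsupport_deriv_subset.trans h.2.2⟩

theorem IsTestFunction.absolutelyContinuous {a b : ℝ} {φ : ℝ → ℝ} (h : IsTestFunction a b φ) :
    AbsolutelyContinuousOnInterval φ a b :=
  (h.1.of_le (by simp)).contDiffOn.absolutelyContinuousOnInterval

theorem integral_Ioo_eq {F : Type*} [NormedAddCommGroup F] [NormedSpace ℝ F] {a b : ℝ}
    (hab : a ≤ b) (f : ℝ → F) : ∫ t in Ioo a b, f t = ∫ t in a..b, f t := by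
  rw [intervalIntegral.integral_of_le hab, integral_Ioc_eq_integral_Ioo]

/-- Integration by parts against test functions for an absolutely continuous function. -/
theorem integral_deriv_mul_of_absolutelyContinuous {a b : ℝ} (hab : a ≤ b) {f g : ℝ → ℝ}
    (hf : AbsolutelyContinuousOnInterval f a b)
    (hg : ∀ᵐ t ∂volume.restrict (Ioo a b), HasDerivAt f (g t) t) {φ : ℝ → ℝ}
    (hφ : IsTestFunction a b φ) :
    ∫ t in Ioo a b, deriv φ t * f t = -∫ t in Ioo a b, φ t * g t := by
  have h := hf.integral_mul_deriv_eq_deriv_mul hφ.absolutelyContinuous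
  rw [hφ.eq_zero_of_notMem (by simp : a ∉ Ioo a b), hφ.eq_zero_of_notMem (by simp : b ∉ Ioo a b),
    mul_zero, mul_zero, sub_zero, zero_sub, ← integral_Ioo_eq hab, ← integral_Ioo_eq hab] at h
  have h1 : ∫ t in Ioo a b, deriv φ t * f t = ∫ t in Ioo a b, f t * deriv φ t := by
    simp_rw [mul_comm]
  rw [h1, h]
  congr 1
  refine integral_congr_ae ?_
  filter_upwards [hg] with t ht
  rw [ht.deriv, mul_comm]

theorem integrableOn_of_absolutelyContinuous {a b : ℝ} (hab : a ≤ b) {f g : ℝ → ℝ}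
    (hf : AbsolutelyContinuousOnInterval f a b)
    (hg : ∀ᵐ t ∂volume.restrict (Ioo a b), HasDerivAt f (g t) t) : IntegrableOn g (Ioo a b) := by
  have h := (intervalIntegrable_iff_integrableOn_Ioo_of_le hab).1 hf.intervalIntegrable_deriv
  refine h.congr ?_
  filter_upwards [hg] with t ht
  exact ht.deriv

theorem plane_ext {x y : Plane} (h0 : x 0 = y 0) (h1 : x 1 = y 1) : x = y := by
  ext i
  fin_cases i
  · exact h0
  · exact h1

theorem hasDerivWithinAt_plane {f : ℝ → Plane} {x y : ℝ} {s : ℝ} {A : Set ℝ}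
    (h0 : HasDerivWithinAt (fun t => f t 0) x A s) (h1 : HasDerivWithinAt (fun t => f t 1) y A s) :
    HasDerivWithinAt f !₂[x, y] A s := by
  have h2 : HasDerivWithinAt (fun t i => f t i) ![x, y] A s := by
    rw [hasDerivWithinAt_pi]
    intro i
    fin_cases i
    · exact h0
    · exact h1
  exact (EuclideanSpace.equiv (Fin 2) ℝ).symm.toContinuousLinearMap.hasFDerivAt
    |>.comp_hasDerivWithinAt s h2

theorem integrable_plane {μ : Measure ℝ} {f : ℝ → Plane} (h0 : Integrable (fun t => f t 0) μ)
    (h1 : Integrable (fun t => f t 1) μ) : Integrable f μ := by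
  have h : ∀ i, Integrable (fun t => f t i) μ := fun i => by
    fin_cases i
    · exact h0
    · exact h1
  have h2 : Integrable (fun t => (EuclideanSpace.equiv (Fin 2) ℝ) (f t)) μ := Integrable.of_eval h
  have h3 := (EuclideanSpace.equiv (Fin 2) ℝ).symm.toContinuousLinearMap.integrable_comp h2
  simpa using h3

theorem integral_plane_apply {μ : Measure ℝ} {f : ℝ → Plane} (h : Integrable f μ) (i : Fin 2) :
    (∫ t, f t ∂μ) i = ∫ t, f t i ∂μ :=
  ((EuclideanSpace.proj i : Plane →L[ℝ] ℝ).integral_comp_comm h).symm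

theorem IntegrableOn.smul_test {F : Type*} [NormedAddCommGroup F] [NormedSpace ℝ F] {a b : ℝ}
    {f : ℝ → F} (hf : IntegrableOn f (Ioo a b)) {φ : ℝ → ℝ} (hφ : IsTestFunction a b φ) :
    IntegrableOn (fun t => φ t • f t) (Ioo a b) := by
  obtain ⟨C, hC⟩ := hφ.2.1.exists_bound_of_continuous hφ.1.continuous
  exact Integrable.bdd_smul hf C hφ.1.continuous.aestronglyMeasurable
    (Eventually.of_forall hC)

theorem hasWeakDeriv_of_absolutelyContinuous {a b : ℝ} (hab : a ≤ b) {f g : ℝ → Plane}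
    (hf0 : AbsolutelyContinuousOnInterval (fun t => f t 0) a b)
    (hf1 : AbsolutelyContinuousOnInterval (fun t => f t 1) a b)
    (hg0 : ∀ᵐ t ∂volume.restrict (Ioo a b), HasDerivAt (fun t => f t 0) (g t 0) t)
    (hg1 : ∀ᵐ t ∂volume.restrict (Ioo a b), HasDerivAt (fun t => f t 1) (g t 1) t) :
    IntegrableOn f (Ioo a b) ∧ IntegrableOn g (Ioo a b) ∧ HasWeakDeriv a b f g := by
  have hc : ∀ {u : ℝ → ℝ}, AbsolutelyContinuousOnInterval u a b → IntegrableOn u (Ioo a b) :=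
    fun hu => by
      have := hu.continuousOn
      rw [uIcc_of_le hab] at this
      exact this.integrableOn_Icc.mono_set Ioo_subset_Icc_self
  have hfi : IntegrableOn f (Ioo a b) := integrable_plane (hc hf0) (hc hf1)
  have hgi : IntegrableOn g (Ioo a b) := integrable_plane
    (integrableOn_of_absolutelyContinuous hab hf0 hg0)
    (integrableOn_of_absolutelyContinuous hab hf1 hg1)
  refine ⟨hfi, hgi, hfi.locallyIntegrableOn, hgi.locallyIntegrableOn, fun φ hφ => ?_⟩
  have h1 := IntegrableOn.smul_test hfi hφ.deriv
  have h2 := IntegrableOn.smul_test hgi hφ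
  refine plane_ext ?_ ?_
  · have := integral_deriv_mul_of_absolutelyContinuous hab hf0 hg0 hφ
    rw [PiLp.neg_apply, integral_plane_apply h1, integral_plane_apply h2]
    simpa using this
  · have := integral_deriv_mul_of_absolutelyContinuous hab hf1 hg1 hφ
    rw [PiLp.neg_apply, integral_plane_apply h1, integral_plane_apply h2]
    simpa using this

end WeakDerivative

/-! ### Regularity and analyticity of a curve with an elastica frame. -/

namespace IsElasticaFrame

variable {p lam C₀ C₁ L : ℝ} {γ : ℝ → Plane} {T₀ T₁ w : ℝ → ℝ}

theorem hasDerivWithinAt (h : IsElasticaFrame p lam C₀ C₁ L γ T₀ T₁ w) {s : ℝ}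
    (hs : s ∈ Icc 0 L) : HasDerivWithinAt γ !₂[T₀ s, T₁ s] (Icc 0 L) s :=
  hasDerivWithinAt_plane (h.deriv_fst s hs) (h.deriv_snd s hs)

theorem hasDerivWithinAt_tangent (h : IsElasticaFrame p lam C₀ C₁ L γ T₀ T₁ w) {s : ℝ}
    (hs : s ∈ Icc 0 L) : HasDerivWithinAt (fun s => (!₂[T₀ s, T₁ s] : Plane))
      !₂[-(spow (p - 1)⁻¹ (w s) * T₁ s), spow (p - 1)⁻¹ (w s) * T₀ s] (Icc 0 L) s :=
  hasDerivWithinAt_plane (h.deriv_T₀ s hs) (h.deriv_T₁ s hs)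

theorem velocity_eq (hL : 0 < L) (h : IsElasticaFrame p lam C₀ C₁ L γ T₀ T₁ w) {s : ℝ}
    (hs : s ∈ Icc 0 L) : velocity 0 L γ s = !₂[T₀ s, T₁ s] :=
  (h.hasDerivWithinAt hs).derivWithin (uniqueDiffOn_Icc hL s hs)

theorem acceleration_eq (hL : 0 < L) (h : IsElasticaFrame p lam C₀ C₁ L γ T₀ T₁ w) {s : ℝ}
    (hs : s ∈ Icc 0 L) : acceleration 0 L γ s =
      !₂[-(spow (p - 1)⁻¹ (w s) * T₁ s), spow (p - 1)⁻¹ (w s) * T₀ s] := by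
  have h1 := (h.hasDerivWithinAt_tangent hs).congr (f₁ := velocity 0 L γ)
    (fun t ht => h.velocity_eq hL ht) (h.velocity_eq hL hs)
  exact h1.derivWithin (uniqueDiffOn_Icc hL s hs)

theorem signedCurvature_eq (hL : 0 < L) (h : IsElasticaFrame p lam C₀ C₁ L γ T₀ T₁ w) {s : ℝ}
    (hs : s ∈ Icc 0 L) : signedCurvature 0 L γ s = spow (p - 1)⁻¹ (w s) := by
  have hn : ‖velocity 0 L γ s‖ = 1 := by
    rw [h.velocity_eq hL hs, EuclideanSpace.norm_eq]
    simp [h.unit s hs]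
  rw [signedCurvature, hn, h.velocity_eq hL hs, h.acceleration_eq hL hs]
  simp
  linear_combination spow (p - 1)⁻¹ (w s) * h.unit s hs

theorem mem_curvatureZeroSet (hL : 0 < L) (h : IsElasticaFrame p lam C₀ C₁ L γ T₀ T₁ w) {s : ℝ}
    (hs : s ∈ Icc 0 L) : s ∈ curvatureZeroSet L γ ↔ w s = 0 := by
  rw [curvatureZeroSet, mem_ofPred_eq, h.signedCurvature_eq hL hs, spow_eq_zero_iff]
  exact and_iff_right hs

theorem contDiffOn (hp : 1 < p) (hL : 0 < L) (h : IsElasticaFrame p lam C₀ C₁ L γ T₀ T₁ w) :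
    ContDiffOn ℝ 2 γ (Icc 0 L) := by
  have hu := uniqueDiffOn_Icc hL
  rw [show (2 : WithTop ℕ∞) = 1 + 1 by norm_num, contDiffOn_succ_iff_derivWithin hu]
  refine ⟨fun s hs => (h.hasDerivWithinAt hs).differentiableWithinAt, by simp, ?_⟩
  rw [show (1 : WithTop ℕ∞) = 0 + 1 by norm_num, contDiffOn_succ_iff_derivWithin hu]
  have hv : ∀ s ∈ Icc 0 L, derivWithin γ (Icc 0 L) s = !₂[T₀ s, T₁ s] := fun s hs =>
    h.velocity_eq hL hs
  refine ⟨fun s hs => ((h.hasDerivWithinAt_tangent hs).congr hv (hv s hs)).differentiableWithinAt,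
    by simp, ?_⟩
  rw [contDiffOn_zero]
  have h1 : ContinuousOn (fun s => (!₂[-(spow (p - 1)⁻¹ (w s) * T₁ s),
      spow (p - 1)⁻¹ (w s) * T₀ s] : Plane)) (Icc 0 L) := by
    have hk := h.continuousOn_curvature hp
    have h0 := h.continuousOn_T₀
    have h1 := h.continuousOn_T₁
    have : ContinuousOn (fun s => ![-(spow (p - 1)⁻¹ (w s) * T₁ s),
      spow (p - 1)⁻¹ (w s) * T₀ s]) (Icc 0 L) := by
      refine continuousOn_pi.2 fun i => ?_
      fin_cases i
      · exact (hk.mul h1).neg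
      · exact hk.mul h0
    exact (PiLp.continuous_toLp 2 _).comp_continuousOn this
  exact h1.congr fun s hs => h.acceleration_eq hL hs

/-- The second derivative k N is a product of absolutely continuous functions, so its almost
everywhere derivative is integrable and is the weak third derivative. -/
theorem memSobolev (hp : 1 < p) (hL : 0 < L) (h : IsElasticaFrame p lam C₀ C₁ L γ T₀ T₁ w) :
    MemSobolev 3 1 0 L γ := by
  set k : ℝ → ℝ := fun t => spow (p - 1)⁻¹ (w t) with hk
  have hkac := h.absolutelyContinuous_curvature hp hL.le
  have hac : ∀ {f g : ℝ → ℝ}, ContinuousOn g (Icc 0 L) →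
      (∀ s ∈ Icc 0 L, HasDerivWithinAt f (g s) (Icc 0 L) s) →
      AbsolutelyContinuousOnInterval f 0 L := by
    intro f g hg hf
    refine ContDiffOn.absolutelyContinuousOnInterval ?_
    rw [uIcc_of_le hL.le, show (1 : WithTop ℕ∞) = 0 + 1 by norm_num,
      contDiffOn_succ_iff_derivWithin (uniqueDiffOn_Icc hL)]
    refine ⟨fun s hs => (hf s hs).differentiableWithinAt, by simp, ?_⟩
    rw [contDiffOn_zero]
    exact hg.congr fun s hs => (hf s hs).derivWithin (uniqueDiffOn_Icc hL s hs)
  have hT0 : AbsolutelyContinuousOnInterval T₀ 0 L :=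
    hac ((h.continuousOn_curvature hp).mul h.continuousOn_T₁).neg h.deriv_T₀
  have hT1 : AbsolutelyContinuousOnInterval T₁ 0 L :=
    hac ((h.continuousOn_curvature hp).mul h.continuousOn_T₀) h.deriv_T₁
  have hγ0 : AbsolutelyContinuousOnInterval (fun s => γ s 0) 0 L :=
    hac h.continuousOn_T₀ h.deriv_fst
  have hγ1 : AbsolutelyContinuousOnInterval (fun s => γ s 1) 0 L :=
    hac h.continuousOn_T₁ h.deriv_snd
  have hN0 : AbsolutelyContinuousOnInterval (fun s => -(k s * T₁ s)) 0 L := (hkac.mul hT1).neg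
  have hN1 : AbsolutelyContinuousOnInterval (fun s => k s * T₀ s) 0 L := hkac.mul hT0
  have hev : ∀ {f g : ℝ → ℝ}, (∀ s ∈ Icc 0 L, HasDerivWithinAt f (g s) (Icc 0 L) s) →
      ∀ᵐ t ∂volume.restrict (Ioo 0 L), HasDerivAt f (g t) t := by
    intro f g hf
    filter_upwards [ae_restrict_mem measurableSet_Ioo] with t ht
    exact (hf t (Ioo_subset_Icc_self ht)).hasDerivAt (Icc_mem_nhds ht.1 ht.2)
  have hev' : ∀ {f : ℝ → ℝ}, AbsolutelyContinuousOnInterval f 0 L →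
      ∀ᵐ t ∂volume.restrict (Ioo 0 L), HasDerivAt f (deriv f t) t := by
    intro f hf
    rw [ae_restrict_iff' measurableSet_Ioo]
    filter_upwards [hf.ae_differentiableAt] with t ht hts
    refine (ht ?_).hasDerivAt
    rw [uIcc_of_le hL.le]
    exact Ioo_subset_Icc_self hts
  let g : ℕ → ℝ → Plane
    | 0 => γ
    | 1 => fun s => !₂[T₀ s, T₁ s]
    | 2 => fun s => !₂[-(k s * T₁ s), k s * T₀ s]
    | _ => fun s => !₂[deriv (fun s => -(k s * T₁ s)) s, deriv (fun s => k s * T₀ s) s]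
  have h0 := hasWeakDeriv_of_absolutelyContinuous hL.le (f := g 0) (g := g 1) hγ0 hγ1
    (hev h.deriv_fst) (hev h.deriv_snd)
  have h1 := hasWeakDeriv_of_absolutelyContinuous hL.le (f := g 1) (g := g 2) hT0 hT1
    (hev h.deriv_T₀) (hev h.deriv_T₁)
  have h2 := hasWeakDeriv_of_absolutelyContinuous hL.le (f := g 2) (g := g 3) hN0 hN1
    (hev' hN0) (hev' hN1)
  refine ⟨g, rfl, fun j hj => ?_, fun j hj => ?_⟩
  · rw [memLp_one_iff_integrable]
    interval_cases j
    · exact h0.1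
    · exact h1.1
    · exact h2.1
    · exact h2.2.1
  · interval_cases j
    · exact h0.2.2
    · exact h1.2.2
    · exact h2.2.2

/-- The quadratic vector field satisfied by `(γ₀, γ₁, T₀, T₁, k, w' / w, k / w, 1)`. -/
noncomputable def quadField (p C₀ C₁ : ℝ) :
    (ℝ × ℝ × ℝ × ℝ × ℝ × ℝ × ℝ × ℝ) →ₗ[ℝ] (ℝ × ℝ × ℝ × ℝ × ℝ × ℝ × ℝ × ℝ) →ₗ[ℝ]
      (ℝ × ℝ × ℝ × ℝ × ℝ × ℝ × ℝ × ℝ) :=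
  LinearMap.mk₂ ℝ
    (fun x y =>
      -- The coordinate that is constantly 1 turns the linear equation γ' = T into a homogeneous
      -- quadratic one.
      let e := x.2.2.2.2.2.2.2
      let k := x.2.2.2.2.1
      let r := x.2.2.2.2.2.2.1
      let T₀ := y.2.2.1
      let T₁ := y.2.2.2.1
      let q := y.2.2.2.2.2.1
      (e * T₀, e * T₁, -(k * T₁), k * T₀, (p - 1)⁻¹ * (k * q),
        -(r * (C₀ * T₀ + C₁ * T₁) / p) - x.2.2.2.2.2.1 * q, ((p - 1)⁻¹ - 1) * (r * q), 0))
    (by intro x x' y; ext <;> simp <;> ring)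
    (by intro c x y; ext <;> simp <;> ring)
    (by intro x y y'; ext <;> simp <;> ring)
    (by intro c x y; ext <;> simp <;> ring)

/-- The functions k, q, r are left free so that the same system serves both where w ≠ 0 and where w
vanishes locally. -/
theorem analyticWithinAt_of_quadField {α₀ α₁ T₀ T₁ k q r : ℝ → ℝ} {s : ℝ} (hs : s ∈ Icc 0 L)
    (hα₀ : α₀ = fun s => γ s 0) (hα₁ : α₁ = fun s => γ s 1)
    (hev : ∀ᶠ t in 𝓝[Icc 0 L] s,
      HasDerivWithinAt α₀ (T₀ t) (Icc 0 L) t ∧ HasDerivWithinAt α₁ (T₁ t) (Icc 0 L) t ∧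
      HasDerivWithinAt T₀ (-(k t * T₁ t)) (Icc 0 L) t ∧
      HasDerivWithinAt T₁ (k t * T₀ t) (Icc 0 L) t ∧
      HasDerivWithinAt k ((p - 1)⁻¹ * (k t * q t)) (Icc 0 L) t ∧
      HasDerivWithinAt q (-(r t * (C₀ * T₀ t + C₁ * T₁ t) / p) - q t * q t) (Icc 0 L) t ∧
      HasDerivWithinAt r (((p - 1)⁻¹ - 1) * (r t * q t)) (Icc 0 L) t) :
    AnalyticWithinAt ℝ γ (Icc 0 L) s := by
  have h1 := analyticWithinAt_of_quadratic_ode (quadField p C₀ C₁).toContinuousBilinearMap hs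
    (y := fun t => (α₀ t, α₁ t, T₀ t, T₁ t, k t, q t, r t, (1 : ℝ))) (by
      filter_upwards [hev] with t ht
      obtain ⟨h1, h2, h3, h4, h5, h6, h7⟩ := ht
      have h8 := hasDerivWithinAt_const t (Icc 0 L) (1 : ℝ)
      have h9 := h1.prodMk (h2.prodMk (h3.prodMk (h4.prodMk (h5.prodMk (h6.prodMk (h7.prodMk h8))))))
      convert! h9 using 1
      simp [quadField])
  have hfst : AnalyticWithinAt ℝ α₀ (Icc 0 L) s :=
    analyticAt_fst.comp_analyticWithinAt h1
  have hsnd : AnalyticWithinAt ℝ α₁ (Icc 0 L) s :=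
    analyticAt_fst.comp_analyticWithinAt (analyticAt_snd.comp_analyticWithinAt h1)
  have hpi : AnalyticWithinAt ℝ (fun t i => γ t i) (Icc 0 L) s := by
    refine AnalyticWithinAt.pi fun i => ?_
    fin_cases i
    · exact hα₀ ▸ hfst
    · exact hα₁ ▸ hsnd
  exact (EuclideanSpace.equiv (Fin 2) ℝ).symm.toContinuousLinearMap.analyticAt _
    |>.comp_analyticWithinAt hpi

/-- With q = w'/w, every power of |w| has logarithmic derivative a multiple of q. Taking k and r =
k/w as unknowns thus removes the non-integer powers from the system. -/
theorem analyticWithinAt_of_ne_zero (h : IsElasticaFrame p lam C₀ C₁ L γ T₀ T₁ w) {s : ℝ}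
    (hs : s ∈ Icc 0 L) (hws : w s ≠ 0) : AnalyticWithinAt ℝ γ (Icc 0 L) s := by
  refine analyticWithinAt_of_quadField (p := p) (C₀ := C₀) (C₁ := C₁) (T₀ := T₀) (T₁ := T₁)
    (k := fun t => spow (p - 1)⁻¹ (w t)) (q := fun t => (C₁ * T₀ t - C₀ * T₁ t) / p / w t)
    (r := fun t => |w t| ^ ((p - 1)⁻¹ - 1)) hs rfl rfl ?_
  filter_upwards [(h.continuousOn_w s hs).eventually_ne hws, self_mem_nhdsWithin] with t hwt ht
  have hw := h.deriv_w t ht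
  have hk : spow (p - 1)⁻¹ (w t) = w t * |w t| ^ ((p - 1)⁻¹ - 1) := rfl
  refine ⟨h.deriv_fst t ht, h.deriv_snd t ht, h.deriv_T₀ t ht, h.deriv_T₁ t ht, ?_, ?_, ?_⟩
  · have := (hasDerivAt_spow (p - 1)⁻¹ hwt).comp_hasDerivWithinAt t hw
    convert! this using 1
    rw [hk]
    field_simp
  · have := ((((h.deriv_T₀ t ht).const_mul C₁).sub ((h.deriv_T₁ t ht).const_mul C₀)).div_const p).div
      hw hwt
    convert! this using 1
    rw [hk]
    simp only [Pi.sub_apply]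
    field_simp
    ring
  · have := (hasDerivAt_abs_rpow_of_ne_zero ((p - 1)⁻¹ - 1) hwt).comp_hasDerivWithinAt t hw
    convert! this using 1
    field_simp

theorem analyticWithinAt_of_eventually_eq_zero (h : IsElasticaFrame p lam C₀ C₁ L γ T₀ T₁ w)
    {s : ℝ} (hs : s ∈ Icc 0 L) (hws : ∀ᶠ t in 𝓝[Icc 0 L] s, w t = 0) :
    AnalyticWithinAt ℝ γ (Icc 0 L) s := by
  refine analyticWithinAt_of_quadField (p := p) (C₀ := C₀) (C₁ := C₁) (T₀ := T₀) (T₁ := T₁)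
    (k := fun _ => 0) (q := fun _ => 0) (r := fun _ => 0) hs rfl rfl ?_
  filter_upwards [hws, self_mem_nhdsWithin] with t hwt ht
  have h0 := h.deriv_T₀ t ht
  have h1 := h.deriv_T₁ t ht
  rw [hwt, spow_zero] at h0 h1
  have hc := hasDerivWithinAt_const t (Icc 0 L) (0 : ℝ)
  refine ⟨h.deriv_fst t ht, h.deriv_snd t ht, h0, h1, ?_, ?_, ?_⟩ <;> simpa using hc

/-- A zero of the curvature outside the relative boundary is relatively interior to the zero set, so
w vanishes near it in [0, L]. -/
theorem analyticOn (hL : 0 < L) (h : IsElasticaFrame p lam C₀ C₁ L γ T₀ T₁ w) :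
    AnalyticOn ℝ γ (Icc 0 L \ relBoundary (Icc 0 L) (curvatureZeroSet L γ)) := by
  rintro s ⟨hs, hsb⟩
  refine AnalyticWithinAt.mono ?_ sdiff_subset
  by_cases hws : w s = 0
  · refine h.analyticWithinAt_of_eventually_eq_zero hs ?_
    have hmem : (⟨s, hs⟩ : Icc 0 L) ∈
        (Subtype.val ⁻¹' curvatureZeroSet L γ : Set (Icc 0 L)) :=
      (h.mem_curvatureZeroSet hL hs).2 hws
    have hint : (⟨s, hs⟩ : Icc 0 L) ∈
        interior (Subtype.val ⁻¹' curvatureZeroSet L γ : Set (Icc 0 L)) := by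
      by_contra hn
      exact hsb ⟨⟨s, hs⟩, ⟨subset_closure hmem, hn⟩, rfl⟩
    have hnh := preimage_coe_mem_nhds_subtype.1 (mem_interior_iff_mem_nhds.1 hint)
    filter_upwards [hnh, self_mem_nhdsWithin] with t ht ht'
    exact (h.mem_curvatureZeroSet hL ht').1 ht
  · exact h.analyticWithinAt_of_ne_zero hs hws

end IsElasticaFrame

/-! ### The du Bois-Reymond lemma. -/

section DuBoisReymond

theorem exists_Icc_of_isCompact {a b : ℝ} (hab : a < b) {K : Set ℝ} (hK : IsCompact K)
    (hKab : K ⊆ Ioo a b) : ∃ a' b', a < a' ∧ a' ≤ b' ∧ b' < b ∧ K ⊆ Icc a' b' := by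
  rcases K.eq_empty_or_nonempty with rfl | hne
  · exact ⟨(a + b) / 2, (a + b) / 2, by linarith, le_rfl, by linarith, empty_subset _⟩
  · refine ⟨sInf K, sSup K, (hKab (hK.sInf_mem hne)).1, ?_, (hKab (hK.sSup_mem hne)).2,
      fun x hx => ⟨csInf_le hK.bddBelow hx, le_csSup hK.bddAbove hx⟩⟩
    exact csInf_le hK.bddBelow (hK.sSup_mem hne)

/-- A test function with vanishing integral is the derivative of a test function. -/
theorem exists_isTestFunction_deriv_eq {a b : ℝ} (hab : a < b) {χ : ℝ → ℝ}
    (hχ : IsTestFunction a b χ) (h0 : ∫ t in Ioo a b, χ t = 0) :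
    ∃ φ, IsTestFunction a b φ ∧ deriv φ = χ := by
  rw [integral_Ioo_eq hab.le] at h0
  obtain ⟨a', b', ha', hab', hb', hK⟩ := exists_Icc_of_isCompact hab hχ.2.1 hχ.2.2
  have hz : ∀ t, t ∉ Icc a' b' → χ t = 0 := fun t ht =>
    image_eq_zero_of_notMem_tsupport fun h => ht (hK h)
  -- The primitive from a vanishes to the left of the support of χ, and to its right because the
  -- total integral is zero.
  have hd : ∀ t, HasDerivAt (fun t => ∫ s in a..t, χ s) (χ t) t := fun t =>
    hχ.1.continuous.integral_hasStrictDerivAt a t |>.hasDerivAt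
  have hderiv : deriv (fun t => ∫ s in a..t, χ s) = χ := funext fun t => (hd t).deriv
  have hsupp : tsupport (fun t => ∫ s in a..t, χ s) ⊆ Icc a' b' := by
    refine closure_minimal (fun t ht => ?_) isClosed_Icc
    by_contra hn
    apply ht
    rw [mem_Icc, not_and_or, not_le, not_le] at hn
    have hzero : ∀ {x y : ℝ}, (∀ s ∈ uIcc x y, χ s = 0) → ∫ s in x..y, χ s = 0 := fun h => by
      rw [intervalIntegral.integral_congr (g := fun _ => (0 : ℝ)) h]
      simp
    rcases hn with hn | hn
    · refine hzero fun s hs => hz s fun hs' => ?_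
      have := hs.2
      rw [le_sup_iff] at this
      rcases this with h | h <;> linarith [hs'.1]
    · have h1 : ∫ s in b..t, χ s = 0 := hzero fun s hs => hz s fun hs' => by
        have := hs.1
        rw [inf_le_iff] at this
        rcases this with h | h <;> linarith [hs'.2]
      have h2 := intervalIntegral.integral_add_adjacent_intervals (μ := volume)
        (hχ.1.continuous.intervalIntegrable a b) (hχ.1.continuous.intervalIntegrable b t)
      simp only
      rw [← h2, h0, h1, add_zero]
  refine ⟨fun t => ∫ s in a..t, χ s, ⟨?_, ?_, ?_⟩, hderiv⟩
  · rw [contDiff_infty_iff_deriv, hderiv]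
    exact ⟨fun t => (hd t).differentiableAt, hχ.1⟩
  · exact isCompact_Icc.of_isClosed_subset (isClosed_tsupport _) hsupp
  · exact hsupp.trans fun t ht => ⟨ha'.trans_le ht.1, ht.2.trans_lt hb'⟩

theorem exists_isTestFunction_integral_eq_one {a b : ℝ} (hab : a < b) :
    ∃ ψ : ℝ → ℝ, IsTestFunction a b ψ ∧ ∫ t in Ioo a b, ψ t = 1 := by
  let B : ContDiffBump ((a + b) / 2) := ⟨(b - a) / 8, (b - a) / 4, by linarith, by linarith⟩
  have hts : tsupport (B.normed volume) ⊆ Ioo a b := by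
    rw [B.tsupport_normed_eq, Real.closedBall_eq_Icc]
    intro x hx
    simp only [B, mem_Icc] at hx
    constructor <;> linarith [hx.1, hx.2]
  refine ⟨B.normed volume, ⟨B.contDiff_normed, B.hasCompactSupport_normed, hts⟩, ?_⟩
  rw [setIntegral_eq_integral_of_forall_compl_eq_zero, B.integral_normed]
  exact fun x hx => image_eq_zero_of_notMem_tsupport fun h => hx (hts h)

theorem IsTestFunction.sub_const_mul {a b : ℝ} {φ ψ : ℝ → ℝ} (hφ : IsTestFunction a b φ)
    (hψ : IsTestFunction a b ψ) (m : ℝ) : IsTestFunction a b (fun t => φ t - m * ψ t) := by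
  refine ⟨hφ.1.sub (contDiff_const.mul hψ.1), ?_, ?_⟩
  · exact hφ.2.1.sub (hψ.2.1.mul_left (f := fun _ => m))
  · refine (tsupport_sub φ (fun t => m * ψ t)).trans (union_subset hφ.2.2 ?_)
    exact (tsupport_mul_subset_right (f := fun _ => m) (g := ψ)).trans hψ.2.2

theorem IsTestFunction.integrableOn {a b : ℝ} {φ : ℝ → ℝ} (hφ : IsTestFunction a b φ) :
    IntegrableOn φ (Ioo a b) :=
  (hφ.1.continuous.integrable_of_hasCompactSupport hφ.2.1).integrableOn

theorem IsTestFunction.integrableOn_mul {a b : ℝ} {φ f : ℝ → ℝ} (hφ : IsTestFunction a b φ)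
    (hf : IntegrableOn f (Ioo a b)) : IntegrableOn (fun t => φ t * f t) (Ioo a b) :=
  IntegrableOn.smul_test hf hφ

theorem ae_eq_zero_of_forall_test {a b : ℝ} {f : ℝ → ℝ} (hf : IntegrableOn f (Ioo a b))
    (h : ∀ φ, IsTestFunction a b φ → ∫ t in Ioo a b, φ t * f t = 0) :
    ∀ᵐ t ∂volume.restrict (Ioo a b), f t = 0 := by
  rw [ae_restrict_iff' measurableSet_Ioo]
  refine isOpen_Ioo.ae_eq_zero_of_integral_contDiff_smul_eq_zero hf.locallyIntegrableOn
    fun φ h1 h2 h3 => ?_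
  have hφ : IsTestFunction a b φ := ⟨h1, h2, h3⟩
  rw [← h φ hφ, setIntegral_eq_integral_of_forall_compl_eq_zero]
  · rfl
  · intro t ht
    rw [hφ.eq_zero_of_notMem ht, zero_mul]

/-- A function whose weak derivative vanishes is constant. -/
theorem ae_eq_const_of_forall_test {a b : ℝ} (hab : a < b) {f : ℝ → ℝ}
    (hf : IntegrableOn f (Ioo a b))
    (h : ∀ φ, IsTestFunction a b φ → ∫ t in Ioo a b, deriv φ t * f t = 0) :
    ∃ c, ∀ᵐ t ∂volume.restrict (Ioo a b), f t = c := by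
  obtain ⟨ψ, hψ, hψ1⟩ := exists_isTestFunction_integral_eq_one hab
  set c := ∫ t in Ioo a b, ψ t * f t with hc
  refine ⟨c, ?_⟩
  have hfc : IntegrableOn (fun t => f t - c) (Ioo a b) := hf.sub (integrableOn_const (by simp))
  have := ae_eq_zero_of_forall_test hfc fun χ hχ => by
    set m := ∫ t in Ioo a b, χ t with hm
    -- Subtracting m ψ gives χ mean zero, so it becomes the derivative of a test function.
    obtain ⟨φ, hφ, hφd⟩ := exists_isTestFunction_deriv_eq hab (hχ.sub_const_mul hψ m) (by
      rw [integral_sub hχ.integrableOn (hψ.integrableOn.const_mul m), integral_const_mul, hψ1]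
      simp [hm])
    have h1 := h φ hφ
    rw [hφd] at h1
    have h2 : ∀ t, (χ t - m * ψ t) * f t = χ t * f t - m * (ψ t * f t) := fun t => by ring
    simp_rw [h2] at h1
    rw [integral_sub (hχ.integrableOn_mul hf) ((hψ.integrableOn_mul hf).const_mul m),
      integral_const_mul, ← hc] at h1
    simp_rw [mul_sub]
    rw [integral_sub (hχ.integrableOn_mul hf) (hχ.integrableOn.mul_const c), integral_mul_const,
      ← hm]
    linarith
  filter_upwards [this] with t ht
  linarith

theorem exists_primitive {a b : ℝ} {g : ℝ → ℝ} (hg : IntegrableOn g (Ioo a b)) :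
    ∃ F : ℝ → ℝ, Continuous F ∧ AbsolutelyContinuousOnInterval F a b ∧
      (∀ t ≤ a, F t = F a) ∧ (∀ t, b ≤ t → F t = F b) ∧
      ∀ᵐ t ∂volume.restrict (Ioo a b), HasDerivAt F (g t) t := by
  have hi : Integrable ((Ioo a b).indicator g) :=
    (integrable_indicator_iff measurableSet_Ioo).2 hg
  have hzero : ∀ {x y : ℝ}, (∀ s ∈ uIcc x y, s ∉ Ioo a b) →
      ∫ s in x..y, (Ioo a b).indicator g s = 0 := fun h => by
    rw [intervalIntegral.integral_congr (g := fun _ => (0 : ℝ))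
      (fun s hs => indicator_of_notMem (h s hs) g)]
    simp
  refine ⟨fun x => ∫ t in a..x, (Ioo a b).indicator g t,
    intervalIntegral.continuous_primitive (fun _ _ => hi.intervalIntegrable) a,
    hi.intervalIntegrable.absolutelyContinuousOnInterval_intervalIntegral left_mem_uIcc,
    fun t ht => ?_, fun t ht => ?_, ?_⟩
  · simp only [intervalIntegral.integral_same]
    refine hzero fun s hs hs' => ?_
    rw [uIcc_of_ge ht] at hs
    linarith [hs.2, hs'.1]
  · simp only
    rw [← intervalIntegral.integral_add_adjacent_intervals (b := b) (hi.intervalIntegrable)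
      (hi.intervalIntegrable), add_eq_left]
    apply hzero
    intro s hs hs'
    rw [uIcc_of_le ht] at hs
    linarith [hs.1, hs'.2]
  · rw [ae_restrict_iff' measurableSet_Ioo]
    filter_upwards [LocallyIntegrable.ae_hasDerivAt_integral hi.locallyIntegrable] with t ht hts
    have := ht a
    rwa [indicator_of_mem hts] at this

/-- A function with an integrable weak derivative agrees almost everywhere with an absolutely
continuous function. -/
theorem exists_absolutelyContinuous_of_weakDeriv {a b : ℝ} (hab : a < b) {f g : ℝ → ℝ}
    (hf : IntegrableOn f (Ioo a b)) (hg : IntegrableOn g (Ioo a b))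
    (h : ∀ φ, IsTestFunction a b φ →
      ∫ t in Ioo a b, deriv φ t * f t = -∫ t in Ioo a b, φ t * g t) :
    ∃ F : ℝ → ℝ, Continuous F ∧ AbsolutelyContinuousOnInterval F a b ∧
      (∀ t ≤ a, F t = F a) ∧ (∀ t, b ≤ t → F t = F b) ∧
      (∀ᵐ t ∂volume.restrict (Ioo a b), HasDerivAt F (g t) t) ∧
      ∀ᵐ t ∂volume.restrict (Ioo a b), f t = F t := by
  obtain ⟨F, hFc, hFac, hFa, hFb, hFd⟩ := exists_primitive hg
  have hFi : IntegrableOn F (Ioo a b) :=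
    hFc.continuousOn.integrableOn_Icc.mono_set Ioo_subset_Icc_self
  obtain ⟨c, hc⟩ := ae_eq_const_of_forall_test hab (f := fun t => f t - F t) (hf.sub hFi)
    fun φ hφ => by
      simp_rw [mul_sub]
      rw [integral_sub (hφ.deriv.integrableOn_mul hf) (hφ.deriv.integrableOn_mul hFi), h φ hφ,
        integral_deriv_mul_of_absolutelyContinuous hab.le hFac hFd hφ, sub_self]
  have hcac : AbsolutelyContinuousOnInterval (fun _ : ℝ => c) a b :=
    (LipschitzWith.const c).lipschitzOnWith.absolutelyContinuousOnInterval
  refine ⟨fun t => F t + c, hFc.add continuous_const, hFac.add hcac, fun t ht => by simp only [hFa t ht],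
    fun t ht => by simp only [hFb t ht], ?_, ?_⟩
  · filter_upwards [hFd] with t ht
    exact ht.add_const c
  · filter_upwards [hc] with t ht
    linarith

/-- Twofold integration of the weak equation `f'' = g'`. -/
theorem exists_absolutelyContinuous_of_weakDeriv_two {a b : ℝ} (hab : a < b) {f g : ℝ → ℝ}
    (hf : IntegrableOn f (Ioo a b)) (hg : IntegrableOn g (Ioo a b))
    (h : ∀ φ, IsTestFunction a b φ →
      ∫ t in Ioo a b, (deriv (deriv φ) t * f t + deriv φ t * g t) = 0) :
    ∃ (C : ℝ) (F : ℝ → ℝ), Continuous F ∧ AbsolutelyContinuousOnInterval F a b ∧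
      (∀ᵐ t ∂volume.restrict (Ioo a b), HasDerivAt F (g t + C) t) ∧
      ∀ᵐ t ∂volume.restrict (Ioo a b), f t = F t := by
  obtain ⟨ψ, hψ, hψ1⟩ := exists_isTestFunction_integral_eq_one hab
  -- The hypothesis only tests f' = g against mean-zero functions φ'; the missing direction ψ
  -- determines the constant.
  set C := -∫ t in Ioo a b, (deriv ψ t * f t + ψ t * g t) with hC
  have hgC : IntegrableOn (fun t => g t + C) (Ioo a b) := hg.add (integrableOn_const (by simp))
  obtain ⟨F, hFc, hFac, -, -, hFd, hF⟩ := exists_absolutelyContinuous_of_weakDeriv hab hf hgC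
    fun ζ hζ => by
      set m := ∫ t in Ioo a b, ζ t with hm
      obtain ⟨φ, hφ, hφd⟩ := exists_isTestFunction_deriv_eq hab (hζ.sub_const_mul hψ m) (by
        rw [integral_sub hζ.integrableOn (hψ.integrableOn.const_mul m), integral_const_mul, hψ1]
        simp [hm])
      have h1 := h φ hφ
      have h3 : ∀ t, deriv (fun t => ζ t - m * ψ t) t = deriv ζ t - m * deriv ψ t := fun t =>
        ((hζ.differentiable t).hasDerivAt.sub
          ((hψ.differentiable t).hasDerivAt.const_mul m)).deriv
      rw [hφd] at h1
      have h2 : ∀ t, deriv (fun t => ζ t - m * ψ t) t * f t + (ζ t - m * ψ t) * g t =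
          (deriv ζ t * f t + ζ t * g t) - m * (deriv ψ t * f t + ψ t * g t) := fun t => by
        rw [h3]; ring
      simp_rw [h2] at h1
      have e1 := hζ.deriv.integrableOn_mul hf
      have e2 := hζ.integrableOn_mul hg
      have e3 : IntegrableOn (fun t => deriv ζ t * f t + ζ t * g t) (Ioo a b) := e1.add e2
      have e4 : IntegrableOn (fun t => deriv ψ t * f t + ψ t * g t) (Ioo a b) :=
        (hψ.deriv.integrableOn_mul hf).add (hψ.integrableOn_mul hg)
      rw [integral_sub e3 (e4.const_mul m), integral_const_mul, integral_add e1 e2] at h1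
      simp_rw [mul_add]
      rw [integral_add e2 (hζ.integrableOn.mul_const C), integral_mul_const, ← hm, hC]
      linarith
  exact ⟨C, F, hFc, hFac, hFd, hF⟩

end DuBoisReymond

/-! ### Calculus of absolutely continuous functions. -/

section AbsolutelyContinuous

theorem absolutelyContinuous_comp_lipschitz {f F : ℝ → ℝ} {a b : ℝ} {K : NNReal} {S : Set ℝ}
    (hf : AbsolutelyContinuousOnInterval f a b) (hS : MapsTo f (uIcc a b) S)
    (hF : LipschitzOnWith K F S) : AbsolutelyContinuousOnInterval (fun t => F (f t)) a b := by
  rw [absolutelyContinuousOnInterval_iff] at hf ⊢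
  intro ε hε
  -- K + 1 rather than K, since K may be 0.
  obtain ⟨δ, hδ, h⟩ := hf (ε / (K + 1)) (by positivity)
  refine ⟨δ, hδ, fun E hE hEδ => ?_⟩
  calc _ ≤ ∑ i ∈ Finset.range E.1, (K : ℝ) * dist (f (E.2 i).1) (f (E.2 i).2) :=
        Finset.sum_le_sum fun i hi =>
          hF.dist_le_mul _ (hS (hE.1 i hi).1) _ (hS (hE.1 i hi).2)
    _ = K * ∑ i ∈ Finset.range E.1, dist (f (E.2 i).1) (f (E.2 i).2) := by rw [Finset.mul_sum]
    _ ≤ K * (ε / (K + 1)) := by gcongr; exact (h E hE hEδ).le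
    _ < (K + 1) * (ε / (K + 1)) := by gcongr; linarith
    _ = ε := by field_simp

/-- An absolutely continuous function with continuous derivative is continuously
differentiable. -/
theorem hasDerivWithinAt_of_absolutelyContinuous {a b : ℝ} (hab : a < b) {f g : ℝ → ℝ}
    (hf : AbsolutelyContinuousOnInterval f a b) (hg : ContinuousOn g (Icc a b))
    (hd : ∀ᵐ t ∂volume.restrict (Ioo a b), HasDerivAt f (g t) t) {t : ℝ} (ht : t ∈ Icc a b) :
    HasDerivWithinAt f (g t) (Icc a b) t := by
  set G := IccExtend hab.le ((Icc a b).domRestrict g) with hG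
  have hGc : Continuous G := (continuousOn_iff_continuous_domRestrict.1 hg).Icc_extend'
  have hGg : ∀ s ∈ Icc a b, G s = g s := fun s hs => by
    rw [hG, IccExtend_of_mem _ _ hs, domRestrict_apply]
  have key : ∀ s ∈ Icc a b, f s = f a + ∫ x in a..s, G x := fun s hs => by
    have h1 := (hf.mono (c := a) (d := s) (by
      rw [uIcc_of_le hs.1, uIcc_of_le hab.le]
      exact Icc_subset_Icc_right hs.2)).integral_deriv_eq_sub
    have h2 : ∫ x in a..s, G x = ∫ x in a..s, deriv f x := by
      rw [← integral_Ioo_eq hs.1, ← integral_Ioo_eq hs.1]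
      refine integral_congr_ae ?_
      have hsub : Ioo a s ⊆ Ioo a b := Ioo_subset_Ioo_right hs.2
      filter_upwards [ae_restrict_of_ae_restrict_of_subset hsub hd,
        ae_restrict_mem measurableSet_Ioo] with x hx hxs
      rw [hx.deriv, hGg x (Ioo_subset_Icc_self (hsub hxs))]
    rw [h2, h1]; ring
  have h3 : HasDerivAt (fun s => f a + ∫ x in a..s, G x) (G t) t :=
    (hGc.integral_hasStrictDerivAt a t).hasDerivAt.const_add (f a)
  rw [← hGg t ht]
  exact h3.hasDerivWithinAt.congr key (key t ht)

end AbsolutelyContinuous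

/-! ### The C¹ representative of a Sobolev immersion. -/

section Representative

/-- The `C¹` representative of the derivative `(G₀, G₁)` of a curve of class `W^{2,p}`, extended
by constants, and its weak second derivative `(h₀, h₁)`. -/
structure IsSobolevRep (p : ℝ) (c : ℝ → Plane) (G₀ G₁ h₀ h₁ : ℝ → ℝ) : Prop where
  cont₀ : Continuous G₀
  cont₁ : Continuous G₁
  memLp₀ : MemLp h₀ (ENNReal.ofReal p) (volume.restrict (Ioo 0 1))
  memLp₁ : MemLp h₁ (ENNReal.ofReal p) (volume.restrict (Ioo 0 1))
  ac₀ : AbsolutelyContinuousOnInterval G₀ 0 1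
  ac₁ : AbsolutelyContinuousOnInterval G₁ 0 1
  ae_deriv₀ : ∀ᵐ t ∂volume.restrict (Ioo 0 1), HasDerivAt G₀ (h₀ t) t
  ae_deriv₁ : ∀ᵐ t ∂volume.restrict (Ioo 0 1), HasDerivAt G₁ (h₁ t) t
  deriv₀ : ∀ t ∈ Icc (0 : ℝ) 1, HasDerivWithinAt (fun t => c t 0) (G₀ t) (Icc 0 1) t
  deriv₁ : ∀ t ∈ Icc (0 : ℝ) 1, HasDerivWithinAt (fun t => c t 1) (G₁ t) (Icc 0 1) t
  pos : ∀ t, 0 < G₀ t ^ 2 + G₁ t ^ 2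

theorem memLp_plane_apply {q : ℝ≥0∞} {μ : Measure ℝ} {f : ℝ → Plane} (hf : MemLp f q μ)
    (i : Fin 2) : MemLp (fun t => f t i) q μ :=
  (EuclideanSpace.proj i : Plane →L[ℝ] ℝ).comp_memLp' hf

theorem HasWeakDeriv.apply {a b : ℝ} {f g : ℝ → Plane} (hf : IntegrableOn f (Ioo a b))
    (hg : IntegrableOn g (Ioo a b)) (h : HasWeakDeriv a b f g) (i : Fin 2) {φ : ℝ → ℝ}
    (hφ : IsTestFunction a b φ) :
    ∫ t in Ioo a b, deriv φ t * f t i = -∫ t in Ioo a b, φ t * g t i := by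
  have h1 := congrArg (fun x : Plane => x i) (h.2.2 φ hφ)
  simp only at h1
  rw [PiLp.neg_apply, integral_plane_apply (IntegrableOn.smul_test hf hφ.deriv),
    integral_plane_apply (IntegrableOn.smul_test hg hφ)] at h1
  simpa using h1

/-- Two integrations: the weak derivative of c has a continuous representative G, and c, being
continuous, equals everywhere on [0, 1] a primitive of G. -/
theorem exists_isSobolevRep_coord {c g₁ g₂ : ℝ → ℝ} (hc : ContinuousOn c (Icc 0 1))
    (h1i : IntegrableOn g₁ (Ioo 0 1)) (h2i : IntegrableOn g₂ (Ioo 0 1))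
    (h01 : ∀ φ, IsTestFunction 0 1 φ →
      ∫ t in Ioo 0 1, deriv φ t * c t = -∫ t in Ioo 0 1, φ t * g₁ t)
    (h12 : ∀ φ, IsTestFunction 0 1 φ →
      ∫ t in Ioo 0 1, deriv φ t * g₁ t = -∫ t in Ioo 0 1, φ t * g₂ t) :
    ∃ G : ℝ → ℝ, Continuous G ∧ AbsolutelyContinuousOnInterval G 0 1 ∧
      (∀ t ≤ 0, G t = G 0) ∧ (∀ t, 1 ≤ t → G t = G 1) ∧
      (∀ᵐ t ∂volume.restrict (Ioo 0 1), HasDerivAt G (g₂ t) t) ∧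
      ∀ t ∈ Icc (0 : ℝ) 1, HasDerivWithinAt c (G t) (Icc 0 1) t := by
  obtain ⟨G, hGc, hGac, hG0, hG1, hGd, hG⟩ :=
    exists_absolutelyContinuous_of_weakDeriv one_pos h1i h2i h12
  have hci : IntegrableOn c (Ioo 0 1) := hc.integrableOn_Icc.mono_set Ioo_subset_Icc_self
  obtain ⟨F, hFc, hFac, -, -, hFd, hF⟩ :=
    exists_absolutelyContinuous_of_weakDeriv one_pos hci h1i h01
  refine ⟨G, hGc, hGac, hG0, hG1, hGd, fun t ht => ?_⟩
  have heq : EqOn c F (Icc 0 1) := by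
    refine Measure.eqOn_Icc_of_ae_eq volume (by norm_num) ?_ hc hFc.continuousOn
    rw [← restrict_Ioo_eq_restrict_Icc]
    exact hF
  have hd : ∀ᵐ t ∂volume.restrict (Ioo (0 : ℝ) 1), HasDerivAt F (G t) t := by
    filter_upwards [hFd, hG] with t ht ht'
    rwa [← ht']
  exact (hasDerivWithinAt_of_absolutelyContinuous one_pos hFac hGc.continuousOn hd ht).congr heq
    (heq ht)

theorem IsSobolevImmersion.exists_rep {p : ℝ} (hp : 1 < p) {c : ℝ → Plane}
    (hc : IsSobolevImmersion p c) : ∃ G₀ G₁ h₀ h₁, IsSobolevRep p c G₀ G₁ h₀ h₁ := by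
  obtain ⟨g, hg0, hgm, hgw⟩ := hc.memSobolev
  have hp1 : 1 ≤ ENNReal.ofReal p := by
    rw [← ENNReal.ofReal_one]; exact ENNReal.ofReal_le_ofReal hp.le
  have hi : ∀ j ≤ 2, IntegrableOn (g j) (Ioo 0 1) := fun j hj => (hgm j hj).integrable hp1
  have hii : ∀ j ≤ 2, ∀ i, IntegrableOn (fun t => g j t i) (Ioo 0 1) := fun j hj i =>
    (memLp_plane_apply (hgm j hj) i).integrable hp1
  have hcc : ∀ i, ContinuousOn (fun t => c t i) (Icc 0 1) := fun i =>
    (EuclideanSpace.proj i : Plane →L[ℝ] ℝ).continuous.comp_continuousOn hc.continuousOn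
  have key := fun i => exists_isSobolevRep_coord (hcc i) (hii 1 (by norm_num) i)
    (hii 2 le_rfl i)
    (fun φ hφ => by
      have := HasWeakDeriv.apply (hi 0 (by norm_num)) (hi 1 (by norm_num)) (hgw 0 (by norm_num)) i hφ
      rwa [hg0] at this)
    (fun φ hφ => HasWeakDeriv.apply (hi 1 (by norm_num)) (hi 2 le_rfl) (hgw 1 (by norm_num)) i hφ)
  obtain ⟨G₀, a1, a2, a3, a4, a5, a6⟩ := key 0
  obtain ⟨G₁, b1, b2, b3, b4, b5, b6⟩ := key 1
  have hpos : ∀ t ∈ Icc (0 : ℝ) 1, 0 < G₀ t ^ 2 + G₁ t ^ 2 := fun t ht => by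
    have hv : velocity 0 1 c t = !₂[G₀ t, G₁ t] :=
      (hasDerivWithinAt_plane (a6 t ht) (b6 t ht)).derivWithin
        (uniqueDiffOn_Icc one_pos t ht)
    have hne := hc.velocity_ne_zero t ht
    rw [hv] at hne
    by_contra! hle
    have h0 : G₀ t = 0 := by nlinarith [sq_nonneg (G₀ t), sq_nonneg (G₁ t)]
    have h1 : G₁ t = 0 := by nlinarith [sq_nonneg (G₀ t), sq_nonneg (G₁ t)]
    exact hne (plane_ext (by simp [h0]) (by simp [h1]))
  refine ⟨G₀, G₁, fun t => g 2 t 0, fun t => g 2 t 1, a1, b1, memLp_plane_apply (hgm 2 le_rfl) 0,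
    memLp_plane_apply (hgm 2 le_rfl) 1, a2, b2, a5, b5, a6, b6, fun t => ?_⟩
  -- G₀ and G₁ are constant beyond the end points, so the immersion condition extends to the whole
  -- line.
  rcases le_or_gt t 0 with ht | ht
  · rw [a3 t ht, b3 t ht]
    exact hpos 0 (by simp)
  · rcases le_or_gt 1 t with ht' | ht'
    · rw [a4 t ht', b4 t ht']
      exact hpos 1 (by simp)
    · exact hpos t ⟨ht.le, ht'.le⟩

end Representative

/-! ### First variation of energy and length. -/

section FirstVariation

theorem hasDerivAt_abs_rpow_eq_spow {p : ℝ} (hp : 1 < p) (x : ℝ) :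
    HasDerivAt (fun x : ℝ => |x| ^ p) (p * spow (p - 1) x) x := by
  have h := hasDerivAt_abs_rpow x hp
  convert! h using 1
  rw [spow, show p - 1 - 1 = p - 2 by ring]
  ring

theorem abs_spow_mul_le {p : ℝ} (hp : 1 < p) {x y H : ℝ} (hx : |x| ≤ H) (hy : |y| ≤ H) :
    |spow (p - 1) x * y| ≤ H ^ p := by
  have hH : 0 ≤ H := (abs_nonneg x).trans hx
  have hp' : 0 < p - 1 := by linarith
  rw [abs_mul, abs_spow hp']
  calc |x| ^ (p - 1) * |y| ≤ H ^ (p - 1) * H := by gcongr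
    _ = H ^ p := by
      rcases hH.eq_or_lt with h | h
      · rw [← h, mul_zero, Real.zero_rpow (by linarith)]
      · rw [Real.rpow_sub_one h.ne']; field_simp

theorem integrable_abs_add_rpow {p : ℝ} (hp : 1 < p) {μ : Measure ℝ} {d e : ℝ → ℝ}
    (hd : MemLp d (ENNReal.ofReal p) μ) (he : MemLp e (ENNReal.ofReal p) μ) :
    Integrable (fun t => (|d t| + |e t|) ^ p) μ := by
  have h := (hd.norm.add he.norm).integrable_norm_rpow (by simp; linarith) ENNReal.ofReal_ne_top
  rw [ENNReal.toReal_ofReal (by linarith)] at h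
  refine h.congr (Eventually.of_forall fun t => ?_)
  simp only [Pi.add_apply, Real.norm_eq_abs]
  rw [abs_of_nonneg (by positivity)]

theorem integrable_spow_mul {p : ℝ} (hp : 1 < p) {μ : Measure ℝ} {d e : ℝ → ℝ}
    (hd : MemLp d (ENNReal.ofReal p) μ) (he : MemLp e (ENNReal.ofReal p) μ) :
    Integrable (fun t => spow (p - 1) (d t) * e t) μ := by
  refine (integrable_abs_add_rpow hp hd he).mono'
    (((continuous_spow (by linarith : 0 < p - 1)).comp_aestronglyMeasurable
      hd.aestronglyMeasurable).mul he.aestronglyMeasurable) (Eventually.of_forall fun t => ?_)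
  rw [Real.norm_eq_abs]
  exact abs_spow_mul_le hp (le_add_of_nonneg_right (abs_nonneg _))
    (le_add_of_nonneg_left (abs_nonneg _))

/-- Differentiation under the integral sign for `∫ |d + ε d₁|^p |(x, y) + ε (x₁, y₁)|^{2 r}`. -/
theorem hasDerivAt_integral_energy {p r : ℝ} (hp : 1 < p) {d d₁ x y x₁ y₁ : ℝ → ℝ}
    (hd : MemLp d (ENNReal.ofReal p) (volume.restrict (Ioo 0 1)))
    (hd₁ : MemLp d₁ (ENNReal.ofReal p) (volume.restrict (Ioo 0 1)))
    (hx : Continuous x) (hy : Continuous y) (hx₁ : Continuous x₁) (hy₁ : Continuous y₁)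
    (hpos : ∀ t, 0 < x t ^ 2 + y t ^ 2) :
    HasDerivAt (fun ε => ∫ t in Ioo (0 : ℝ) 1, |d t + ε * d₁ t| ^ p *
        ((x t + ε * x₁ t) ^ 2 + (y t + ε * y₁ t) ^ 2) ^ r)
      (∫ t in Ioo (0 : ℝ) 1, (p * spow (p - 1) (d t) * d₁ t * (x t ^ 2 + y t ^ 2) ^ r +
        |d t| ^ p * (r * (x t ^ 2 + y t ^ 2) ^ (r - 1) * (2 * (x t * x₁ t + y t * y₁ t))))) 0 := by
  set N : ℝ × ℝ → ℝ := fun z => (x z.2 + z.1 * x₁ z.2) ^ 2 + (y z.2 + z.1 * y₁ z.2) ^ 2 with hN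
  have hNc : Continuous N := by fun_prop
  have hNpos : ∀ᶠ ε in 𝓝 (0 : ℝ), ∀ t ∈ Icc (0 : ℝ) 1, 0 < N (ε, t) := by
    -- Compactness of [0, 1] keeps the perturbed speed positive uniformly in t for small ε.
    refine isCompact_Icc.eventually_forall_of_forall_eventually fun t _ => ?_
    have h0 : 0 < N (0, t) := by simpa [hN] using hpos t
    exact hNc.continuousAt.eventually (lt_mem_nhds h0)
  obtain ⟨δ₀, hδ₀, hδN⟩ := Metric.eventually_nhds_iff_ball.1 hNpos
  -- The bound δ ≤ 1 gives |d + ε d₁| ≤ |d| + |d₁|, whose p-th power is the dominating function up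
  -- to a constant.
  set δ := min (δ₀ / 2) 1 with hδ
  have hδpos : 0 < δ := by positivity
  have hδ1 : δ ≤ 1 := min_le_right _ _
  have hδδ₀ : δ < δ₀ := (min_le_left _ _).trans_lt (by linarith)
  have hK : IsCompact (Metric.closedBall (0 : ℝ) δ ×ˢ Icc (0 : ℝ) 1) :=
    (isCompact_closedBall 0 δ).prod isCompact_Icc
  have hNK : ∀ z ∈ Metric.closedBall (0 : ℝ) δ ×ˢ Icc (0 : ℝ) 1, 0 < N z := fun z hz =>
    hδN z.1 (Metric.closedBall_subset_ball hδδ₀ hz.1) z.2 hz.2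
  have hNr : ∀ q : ℝ, ContinuousOn (fun z => N z ^ q)
      (Metric.closedBall (0 : ℝ) δ ×ˢ Icc (0 : ℝ) 1) := fun q =>
    hNc.continuousOn.rpow_const fun z hz => Or.inl (hNK z hz).ne'
  obtain ⟨C₁, hC₁⟩ := hK.exists_bound_of_continuousOn (hNr r)
  have hdNc : ContinuousOn (fun z : ℝ × ℝ => r * N z ^ (r - 1) *
      (2 * ((x z.2 + z.1 * x₁ z.2) * x₁ z.2 + (y z.2 + z.1 * y₁ z.2) * y₁ z.2)))
      (Metric.closedBall (0 : ℝ) δ ×ˢ Icc (0 : ℝ) 1) :=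
    (continuousOn_const.mul (hNr (r - 1))).mul (by fun_prop)
  obtain ⟨C₂, hC₂⟩ := hK.exists_bound_of_continuousOn hdNc
  have hH := integrable_abs_add_rpow hp hd hd₁
  have hmeasD : ∀ ε : ℝ, AEStronglyMeasurable (fun t => d t + ε * d₁ t)
      (volume.restrict (Ioo 0 1)) := fun ε =>
    hd.aestronglyMeasurable.add (hd₁.aestronglyMeasurable.const_mul ε)
  have hmeasP : ∀ ε : ℝ, AEStronglyMeasurable (fun t => |d t + ε * d₁ t| ^ p)
      (volume.restrict (Ioo 0 1)) := fun ε =>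
    (continuous_abs.rpow_const fun _ => Or.inr (by linarith)).comp_aestronglyMeasurable (hmeasD ε)
  have hmeasN : ∀ q ε : ℝ, AEStronglyMeasurable
      (fun t => ((x t + ε * x₁ t) ^ 2 + (y t + ε * y₁ t) ^ 2) ^ q)
      (volume.restrict (Ioo 0 1)) := fun q ε =>
    Measurable.aestronglyMeasurable (by fun_prop)
  have habs : ∀ ε ∈ Metric.ball (0 : ℝ) δ, ∀ t, |d t + ε * d₁ t| ≤ |d t| + |d₁ t| := by
    intro ε hε t
    rw [mem_ball_zero_iff, Real.norm_eq_abs] at hε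
    refine (abs_add_le _ _).trans (add_le_add le_rfl ?_)
    rw [abs_mul]
    exact mul_le_of_le_one_left (abs_nonneg _) (hε.le.trans hδ1)
  have hmem : ∀ ε ∈ Metric.ball (0 : ℝ) δ, ∀ t ∈ Ioo (0 : ℝ) 1,
      (ε, t) ∈ Metric.closedBall (0 : ℝ) δ ×ˢ Icc (0 : ℝ) 1 := fun ε hε t ht =>
    ⟨Metric.ball_subset_closedBall hε, Ioo_subset_Icc_self ht⟩
  have h := (hasDerivAt_integral_of_dominated_loc_of_deriv_le (μ := volume.restrict (Ioo (0 : ℝ) 1))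
    (F := fun ε t => |d t + ε * d₁ t| ^ p *
        ((x t + ε * x₁ t) ^ 2 + (y t + ε * y₁ t) ^ 2) ^ r)
    (F' := fun ε t => p * spow (p - 1) (d t + ε * d₁ t) * d₁ t *
        ((x t + ε * x₁ t) ^ 2 + (y t + ε * y₁ t) ^ 2) ^ r +
        |d t + ε * d₁ t| ^ p * (r * ((x t + ε * x₁ t) ^ 2 + (y t + ε * y₁ t) ^ 2) ^ (r - 1) *
          (2 * ((x t + ε * x₁ t) * x₁ t + (y t + ε * y₁ t) * y₁ t))))
    (bound := fun t => (p * C₁ + C₂) * (|d t| + |d₁ t|) ^ p)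
    (x₀ := 0) (s := Metric.ball 0 δ) (Metric.ball_mem_nhds 0 hδpos)
    (Eventually.of_forall fun ε => (hmeasP ε).mul (hmeasN r ε)) ?_ ?_ ?_ ?_ ?_).2
  · simpa using h
  · refine (hH.const_mul C₁).mono' ((hmeasP 0).mul (hmeasN r 0)) ?_
    filter_upwards [ae_restrict_mem measurableSet_Ioo] with t ht
    have h1 := hC₁ (0, t) (hmem 0 (Metric.mem_ball_self hδpos) t ht)
    rw [norm_mul, mul_comm, Real.norm_of_nonneg (Real.rpow_nonneg (abs_nonneg _) _)]
    exact mul_le_mul h1 (Real.rpow_le_rpow (abs_nonneg _)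
      (habs 0 (Metric.mem_ball_self hδpos) t) (by linarith)) (by positivity)
      ((norm_nonneg _).trans h1)
  · refine AEStronglyMeasurable.add (AEStronglyMeasurable.mul (AEStronglyMeasurable.mul
      (AEStronglyMeasurable.const_mul ?_ p) hd₁.aestronglyMeasurable) (hmeasN r 0))
      ((hmeasP 0).mul (AEStronglyMeasurable.mul (AEStronglyMeasurable.const_mul
        (hmeasN (r - 1) 0) r) ?_))
    · exact (continuous_spow (by linarith)).comp_aestronglyMeasurable (hmeasD 0)
    · exact Continuous.aestronglyMeasurable (by fun_prop)
  · filter_upwards [ae_restrict_mem measurableSet_Ioo] with t ht ε hε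
    have h1 := hC₁ (ε, t) (hmem ε hε t ht)
    have h2 := hC₂ (ε, t) (hmem ε hε t ht)
    have hC₁0 : 0 ≤ C₁ := (norm_nonneg _).trans h1
    have h3 := habs ε hε t
    have h4 := abs_spow_mul_le hp h3
      (le_add_of_nonneg_left (abs_nonneg (d t)) : |d₁ t| ≤ |d t| + |d₁ t|)
    have h5 : |d t + ε * d₁ t| ^ p ≤ (|d t| + |d₁ t|) ^ p :=
      Real.rpow_le_rpow (abs_nonneg _) h3 (by linarith)
    refine (norm_add_le _ _).trans ?_
    have h6 : (p * C₁ + C₂) * (|d t| + |d₁ t|) ^ p =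
        p * C₁ * (|d t| + |d₁ t|) ^ p + C₂ * (|d t| + |d₁ t|) ^ p := add_mul _ _ _
    simp only [h6]
    refine add_le_add ?_ ?_
    · rw [norm_mul, mul_assoc p, norm_mul, Real.norm_of_nonneg (by linarith : 0 ≤ p),
        mul_right_comm]
      exact mul_le_mul (mul_le_mul_of_nonneg_left h1 (by linarith)) h4 (norm_nonneg _)
        (by positivity)
    · rw [norm_mul, mul_comm, Real.norm_of_nonneg (Real.rpow_nonneg (abs_nonneg _) _)]
      exact mul_le_mul h2 h5 (by positivity) ((norm_nonneg _).trans h2)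
  · exact hH.const_mul _
  · filter_upwards [ae_restrict_mem measurableSet_Ioo] with t ht ε hε
    have hNt := hNK (ε, t) (hmem ε hε t ht)
    have e1 : HasDerivAt (fun ε => d t + ε * d₁ t) (d₁ t) ε := by
      simpa using ((hasDerivAt_id ε).mul_const (d₁ t)).const_add (d t)
    have e2 : HasDerivAt (fun ε => x t + ε * x₁ t) (x₁ t) ε := by
      simpa using ((hasDerivAt_id ε).mul_const (x₁ t)).const_add (x t)
    have e3 : HasDerivAt (fun ε => y t + ε * y₁ t) (y₁ t) ε := by
      simpa using ((hasDerivAt_id ε).mul_const (y₁ t)).const_add (y t)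
    have e4 := (hasDerivAt_abs_rpow_eq_spow hp (d t + ε * d₁ t)).comp ε e1
    have e5 := ((e2.pow 2).add (e3.pow 2)).rpow_const (p := r) (Or.inl hNt.ne')
    have e6 := e4.mul e5
    convert! e6 using 1
    simp only [Pi.add_apply, Pi.pow_apply, Function.comp]
    push_cast
    ring

variable {p : ℝ} {c : ℝ → Plane} {G₀ G₁ h₀ h₁ : ℝ → ℝ}

theorem hasDerivAt_plane {f : ℝ → Plane} {u v t : ℝ}
    (h0 : HasDerivAt (fun t => f t 0) u t) (h1 : HasDerivAt (fun t => f t 1) v t) :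
    HasDerivAt f !₂[u, v] t := by
  rw [← hasDerivWithinAt_univ] at *
  exact hasDerivWithinAt_plane h0 h1

theorem IsSobolevRep.velocity_add (h : IsSobolevRep p c G₀ G₁ h₀ h₁) {φ : ℝ → ℝ}
    (hφ : IsTestFunction 0 1 φ) (e : Plane) (ε : ℝ) {t : ℝ} (ht : t ∈ Icc (0 : ℝ) 1) :
    velocity 0 1 (c + ε • fun t => φ t • e) t =
      !₂[G₀ t + ε * (deriv φ t * e 0), G₁ t + ε * (deriv φ t * e 1)] := by
  refine (hasDerivWithinAt_plane ?_ ?_).derivWithin (uniqueDiffOn_Icc one_pos t ht)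
  · exact (h.deriv₀ t ht).add
      ((((hφ.differentiable t).hasDerivAt.mul_const (e 0)).const_mul ε).hasDerivWithinAt)
  · exact (h.deriv₁ t ht).add
      ((((hφ.differentiable t).hasDerivAt.mul_const (e 1)).const_mul ε).hasDerivWithinAt)

/-- The perturbation is smooth, so one null set, that of G₀ and G₁, serves every ε. -/
theorem IsSobolevRep.ae_acceleration_add (h : IsSobolevRep p c G₀ G₁ h₀ h₁) {φ : ℝ → ℝ}
    (hφ : IsTestFunction 0 1 φ) (e : Plane) :
    ∀ᵐ t ∂volume.restrict (Ioo (0 : ℝ) 1), ∀ ε : ℝ,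
      acceleration 0 1 (c + ε • fun t => φ t • e) t =
      !₂[h₀ t + ε * (deriv (deriv φ) t * e 0), h₁ t + ε * (deriv (deriv φ) t * e 1)] := by
  filter_upwards [h.ae_deriv₀, h.ae_deriv₁, ae_restrict_mem measurableSet_Ioo] with t h0 h1 ht ε
  have hd : HasDerivAt (fun t => (!₂[G₀ t + ε * (deriv φ t * e 0),
      G₁ t + ε * (deriv φ t * e 1)] : Plane))
      !₂[h₀ t + ε * (deriv (deriv φ) t * e 0), h₁ t + ε * (deriv (deriv φ) t * e 1)] t := by
    refine hasDerivAt_plane ?_ ?_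
    · exact h0.add (((hφ.deriv.differentiable t).hasDerivAt.mul_const (e 0)).const_mul ε)
    · exact h1.add (((hφ.deriv.differentiable t).hasDerivAt.mul_const (e 1)).const_mul ε)
  have ht' := Ioo_subset_Icc_self ht
  exact (hd.hasDerivWithinAt.congr (fun s hs => h.velocity_add hφ e ε hs)
    (h.velocity_add hφ e ε ht')).derivWithin (uniqueDiffOn_Icc one_pos t ht')

theorem norm_plane (u v : ℝ) : ‖(!₂[u, v] : Plane)‖ = (u ^ 2 + v ^ 2) ^ (1 / 2 : ℝ) := by
  rw [EuclideanSpace.norm_eq, ← Real.sqrt_eq_rpow]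
  simp

/-- The case N = 0 holds by the conventions for division and powers, so the formula for the energy
is valid for all ε, even if the perturbed curve is not immersed. -/
theorem curvature_integrand_eq {p : ℝ} (hp : 1 < p) (D N : ℝ) (hN : 0 ≤ N) :
    |D / (N ^ (1 / 2 : ℝ)) ^ 3| ^ p * N ^ (1 / 2 : ℝ) = |D| ^ p * N ^ ((1 - 3 * p) / 2) := by
  rcases hN.eq_or_lt with rfl | hN
  · rw [Real.zero_rpow (by norm_num), Real.zero_rpow (by linarith)]
    simp
  · have h3 : (N ^ (1 / 2 : ℝ)) ^ 3 = N ^ (3 / 2 : ℝ) := by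
      rw [← Real.rpow_natCast, ← Real.rpow_mul hN.le]; norm_num
    rw [h3, abs_div, abs_of_pos (Real.rpow_pos_of_pos hN _),
      Real.div_rpow (abs_nonneg _) (Real.rpow_nonneg hN.le _), ← Real.rpow_mul hN.le,
      div_mul_eq_mul_div, mul_div_assoc, ← Real.rpow_sub hN]
    congr 2
    ring

theorem IsSobolevRep.memLp_det (h : IsSobolevRep p c G₀ G₁ h₀ h₁) {u v : ℝ → ℝ}
    (hu : Continuous u) (hv : Continuous v) :
    MemLp (fun t => u t * h₁ t - v t * h₀ t) (ENNReal.ofReal p) (volume.restrict (Ioo 0 1)) := by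
  have hb : ∀ {u f : ℝ → ℝ}, Continuous u →
      MemLp f (ENNReal.ofReal p) (volume.restrict (Ioo 0 1)) →
      MemLp (fun t => u t * f t) (ENNReal.ofReal p) (volume.restrict (Ioo 0 1)) := by
    intro u f hu hf
    obtain ⟨C, hC⟩ := (isCompact_Icc (a := (0 : ℝ)) (b := 1)).exists_bound_of_continuousOn
      hu.continuousOn
    refine (hf.const_mul C).mono (hu.aestronglyMeasurable.mul hf.aestronglyMeasurable) ?_
    filter_upwards [ae_restrict_mem measurableSet_Ioo] with t ht
    rw [norm_mul, norm_mul]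
    exact mul_le_mul_of_nonneg_right ((hC t (Ioo_subset_Icc_self ht)).trans (le_abs_self C))
      (norm_nonneg _)
  exact (hb hu h.memLp₁).sub (hb hv h.memLp₀)

/-- The first variation of the bending energy. -/
theorem IsSobolevRep.hasDerivAt_bendingEnergy (hp : 1 < p) (h : IsSobolevRep p c G₀ G₁ h₀ h₁)
    {φ : ℝ → ℝ} (hφ : IsTestFunction 0 1 φ) (e : Plane) :
    HasDerivAt (fun ε : ℝ => bendingEnergy p 0 1 (c + ε • fun t => φ t • e))
      (∫ t in Ioo (0 : ℝ) 1, (p * spow (p - 1) (G₀ t * h₁ t - G₁ t * h₀ t) *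
          (deriv φ t * (e 0 * h₁ t - e 1 * h₀ t) +
            deriv (deriv φ) t * (G₀ t * e 1 - G₁ t * e 0)) *
          (G₀ t ^ 2 + G₁ t ^ 2) ^ ((1 - 3 * p) / 2) +
        |G₀ t * h₁ t - G₁ t * h₀ t| ^ p * ((1 - 3 * p) / 2 *
          (G₀ t ^ 2 + G₁ t ^ 2) ^ ((1 - 3 * p) / 2 - 1) *
          (2 * (G₀ t * (deriv φ t * e 0) + G₁ t * (deriv φ t * e 1)))))) 0 := by
  have c1 := hφ.deriv.1.continuous
  have c2 := hφ.deriv.deriv.1.continuous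
  have hd := h.memLp_det h.cont₀ h.cont₁
  have hd₁ : MemLp (fun t => deriv φ t * (e 0 * h₁ t - e 1 * h₀ t) +
      deriv (deriv φ) t * (G₀ t * e 1 - G₁ t * e 0)) (ENNReal.ofReal p)
      (volume.restrict (Ioo 0 1)) := by
    have h1 := h.memLp_det (u := fun t => deriv φ t * e 0) (v := fun t => deriv φ t * e 1)
      (by fun_prop) (by fun_prop)
    have h2 : Continuous fun t => deriv (deriv φ) t * (G₀ t * e 1 - G₁ t * e 0) := by
      have := h.cont₀
      have := h.cont₁
      fun_prop
    obtain ⟨C, hC⟩ := (isCompact_Icc (a := (0 : ℝ)) (b := 1)).exists_bound_of_continuousOn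
      h2.continuousOn
    have h3 : MemLp (fun t => deriv (deriv φ) t * (G₀ t * e 1 - G₁ t * e 0)) (ENNReal.ofReal p)
        (volume.restrict (Ioo 0 1)) := by
      refine MemLp.of_bound h2.aestronglyMeasurable C ?_
      filter_upwards [ae_restrict_mem measurableSet_Ioo] with t ht
      exact hC t (Ioo_subset_Icc_self ht)
    refine (h1.add h3).ae_eq (Eventually.of_forall fun t => ?_)
    simp only [Pi.add_apply]
    ring
  have key := hasDerivAt_integral_energy (r := (1 - 3 * p) / 2) hp hd hd₁ h.cont₀ h.cont₁
    (x₁ := fun t => deriv φ t * e 0) (y₁ := fun t => deriv φ t * e 1) (by fun_prop) (by fun_prop)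
    h.pos
  refine key.congr_of_eventuallyEq (Eventually.of_forall fun ε => ?_)
  simp only [bendingEnergy]
  refine integral_congr_ae ?_
  filter_upwards [h.ae_acceleration_add hφ e, ae_restrict_mem measurableSet_Ioo] with t hta ht
  rw [signedCurvature, hta ε, h.velocity_add hφ e ε (Ioo_subset_Icc_self ht), norm_plane,
    curvature_integrand_eq hp _ _ (by positivity)]
  -- The determinant is affine in ε: for η = φ e with e fixed, η' and η'' are parallel, so the ε²
  -- terms cancel.
  congr 3
  simp
  ring

/-- The first variation of the length. -/
theorem IsSobolevRep.hasDerivAt_curveLength (hp : 1 < p) (h : IsSobolevRep p c G₀ G₁ h₀ h₁)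
    {φ : ℝ → ℝ} (hφ : IsTestFunction 0 1 φ) (e : Plane) :
    HasDerivAt (fun ε : ℝ => curveLength 0 1 (c + ε • fun t => φ t • e))
      (∫ t in Ioo (0 : ℝ) 1, 1 / 2 * (G₀ t ^ 2 + G₁ t ^ 2) ^ (1 / 2 - 1 : ℝ) *
          (2 * (G₀ t * (deriv φ t * e 0) + G₁ t * (deriv φ t * e 1)))) 0 := by
  have c1 := hφ.deriv.1.continuous
  -- The length is the energy integral with the curvature factor frozen at 1.
  have key := hasDerivAt_integral_energy (r := 1 / 2) hp (d := fun _ => 1) (d₁ := fun _ => 0)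
    (memLp_const 1) (memLp_const 0) h.cont₀ h.cont₁
    (x₁ := fun t => deriv φ t * e 0) (y₁ := fun t => deriv φ t * e 1) (by fun_prop) (by fun_prop)
    h.pos
  simp only [mul_zero, zero_mul, add_zero, zero_add, abs_one, Real.one_rpow, one_mul] at key
  refine key.congr_of_eventuallyEq (Eventually.of_forall fun ε => ?_)
  simp only [curveLength]
  refine setIntegral_congr_fun measurableSet_Ioo fun t ht => ?_
  rw [h.velocity_add hφ e ε (Ioo_subset_Icc_self ht), norm_plane]

end FirstVariation

/-! ### The Euler–Lagrange equation and its conserved vector. -/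

section EulerLagrange

theorem spow_mul_of_pos {α : ℝ} (x : ℝ) {y : ℝ} (hy : 0 < y) :
    spow α (x * y) = spow α x * y ^ α := by
  rw [spow, spow, abs_mul, abs_of_pos hy, Real.mul_rpow (abs_nonneg _) hy.le,
    Real.rpow_sub_one hy.ne']
  field_simp

theorem mul_spow_self {α : ℝ} (hα : 0 < α) (x : ℝ) : spow (α - 1) x * x = |x| ^ α := by
  rcases eq_or_ne x 0 with rfl | hx
  · simp [Real.zero_rpow hα.ne']
  · have h : 0 < |x| := abs_pos.2 hx
    rw [spow, Real.rpow_sub_one h.ne', Real.rpow_sub_one h.ne']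
    field_simp
    rw [sq_abs]

theorem integrableOn_continuous_mul {u f : ℝ → ℝ} (hu : Continuous u)
    (hf : IntegrableOn f (Ioo 0 1)) : IntegrableOn (fun t => u t * f t) (Ioo 0 1) := by
  obtain ⟨C, hC⟩ := (isCompact_Icc (a := (0 : ℝ)) (b := 1)).exists_bound_of_continuousOn
    hu.continuousOn
  refine Integrable.bdd_smul hf C hu.aestronglyMeasurable ?_
  filter_upwards [ae_restrict_mem measurableSet_Ioo] with t ht
  exact hC t (Ioo_subset_Icc_self ht)

variable {p : ℝ} {c : ℝ → Plane} {G₀ G₁ h₀ h₁ : ℝ → ℝ}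

theorem IsSobolevRep.continuous_rpow (h : IsSobolevRep p c G₀ G₁ h₀ h₁) (q : ℝ) :
    Continuous fun t => (G₀ t ^ 2 + G₁ t ^ 2) ^ q := by
  have h0 := h.cont₀
  have h1 := h.cont₁
  exact Continuous.rpow_const (by fun_prop) fun t => Or.inl (h.pos t).ne'

theorem IsTestFunction.smul_const {φ : ℝ → ℝ} {a b : ℝ} (hφ : IsTestFunction a b φ) (e : Plane) :
    IsTestFunction a b fun t => φ t • e := by
  refine ⟨hφ.1.smul contDiff_const, hφ.2.1.smul_right, ?_⟩
  exact (tsupport_smul_subset_left φ fun _ => e).trans hφ.2.2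

/-- The Euler--Lagrange equation in weak form. -/
theorem IsSobolevRep.weak_euler_lagrange (hp : 1 < p) (h : IsSobolevRep p c G₀ G₁ h₀ h₁)
    {lam : ℝ} (hcrit : ∀ η : ℝ → Plane, IsTestFunction 0 1 η →
      HasDerivAt (fun ε : ℝ =>
        bendingEnergy p 0 1 (c + ε • η) + lam * curveLength 0 1 (c + ε • η)) 0 0)
    {U S : ℝ → ℝ}
    (hU : U = fun t => spow (p - 1) (G₀ t * h₁ t - G₁ t * h₀ t) *
      (G₀ t ^ 2 + G₁ t ^ 2) ^ ((1 - 3 * p) / 2))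
    (hS : S = fun t => (1 - 3 * p) * (|G₀ t * h₁ t - G₁ t * h₀ t| ^ p *
      (G₀ t ^ 2 + G₁ t ^ 2) ^ ((1 - 3 * p) / 2 - 1)) +
      lam * (G₀ t ^ 2 + G₁ t ^ 2) ^ (1 / 2 - 1 : ℝ)) (e : Plane) :
    IntegrableOn (fun t => p * U t * (G₀ t * e 1 - G₁ t * e 0)) (Ioo 0 1) ∧
    IntegrableOn (fun t => p * U t * (e 0 * h₁ t - e 1 * h₀ t) +
      S t * (G₀ t * e 0 + G₁ t * e 1)) (Ioo 0 1) ∧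
    ∀ φ, IsTestFunction 0 1 φ → ∫ t in Ioo 0 1, (deriv (deriv φ) t *
      (p * U t * (G₀ t * e 1 - G₁ t * e 0)) + deriv φ t *
      (p * U t * (e 0 * h₁ t - e 1 * h₀ t) + S t * (G₀ t * e 0 + G₁ t * e 1))) = 0 := by
  have hc0 := h.cont₀
  have hc1 := h.cont₁
  have hd := h.memLp_det hc0 hc1
  have hp0 : 0 < p := by linarith
  have hA : IntegrableOn (fun t => p * U t * (G₀ t * e 1 - G₁ t * e 0)) (Ioo 0 1) := by
    have h1 := integrable_spow_mul hp hd (memLp_const (1 : ℝ))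
    have h2 := integrableOn_continuous_mul (u := fun t => p * (G₀ t * e 1 - G₁ t * e 0) *
      (G₀ t ^ 2 + G₁ t ^ 2) ^ ((1 - 3 * p) / 2))
      (Continuous.mul (by fun_prop) (h.continuous_rpow _)) h1
    refine h2.congr_fun (fun t _ => ?_) measurableSet_Ioo
    simp only [hU]
    ring
  have hB1 : IntegrableOn (fun t => p * U t * (e 0 * h₁ t - e 1 * h₀ t) +
      (1 - 3 * p) * (|G₀ t * h₁ t - G₁ t * h₀ t| ^ p *
      (G₀ t ^ 2 + G₁ t ^ 2) ^ ((1 - 3 * p) / 2 - 1)) * (G₀ t * e 0 + G₁ t * e 1)) (Ioo 0 1) := by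
    have h1 := integrable_spow_mul hp hd (h.memLp_det (u := fun _ => e 0) (v := fun _ => e 1)
      continuous_const continuous_const)
    have h2 := integrableOn_continuous_mul (u := fun t => p *
      (G₀ t ^ 2 + G₁ t ^ 2) ^ ((1 - 3 * p) / 2)) (continuous_const.mul (h.continuous_rpow _)) h1
    have h3 := hd.integrable_norm_rpow (by simpa using hp0) ENNReal.ofReal_ne_top
    rw [ENNReal.toReal_ofReal hp0.le] at h3
    have h4 := integrableOn_continuous_mul (u := fun t => (1 - 3 * p) * (G₀ t * e 0 + G₁ t * e 1) *
      (G₀ t ^ 2 + G₁ t ^ 2) ^ ((1 - 3 * p) / 2 - 1))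
      (Continuous.mul (by fun_prop) (h.continuous_rpow _)) h3
    refine (h2.add h4).congr_fun (fun t _ => ?_) measurableSet_Ioo
    simp only [Pi.add_apply, hU, Real.norm_eq_abs]
    ring
  have hB2 : IntegrableOn (fun t => (G₀ t ^ 2 + G₁ t ^ 2) ^ (1 / 2 - 1 : ℝ) *
      (G₀ t * e 0 + G₁ t * e 1)) (Ioo 0 1) := by
    have : Continuous fun t => (G₀ t ^ 2 + G₁ t ^ 2) ^ (1 / 2 - 1 : ℝ) *
      (G₀ t * e 0 + G₁ t * e 1) := (h.continuous_rpow _).mul (by fun_prop)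
    exact this.continuousOn.integrableOn_Icc.mono_set Ioo_subset_Icc_self
  refine ⟨hA, ?_, fun φ hφ => ?_⟩
  · refine (hB1.add (hB2.const_mul lam)).congr_fun (fun t _ => ?_) measurableSet_Ioo
    simp only [Pi.add_apply, hS]
    ring
  · have hv := ((h.hasDerivAt_bendingEnergy hp hφ e).add
      ((h.hasDerivAt_curveLength hp hφ e).const_mul lam)).unique (hcrit _ (hφ.smul_const e))
    have h1 := hφ.deriv.deriv.integrableOn_mul hA
    have h2 := hφ.deriv.integrableOn_mul hB1
    have h3 := hφ.deriv.integrableOn_mul hB2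
    have e1 : ∫ t in Ioo (0 : ℝ) 1, (p * spow (p - 1) (G₀ t * h₁ t - G₁ t * h₀ t) *
          (deriv φ t * (e 0 * h₁ t - e 1 * h₀ t) +
            deriv (deriv φ) t * (G₀ t * e 1 - G₁ t * e 0)) *
          (G₀ t ^ 2 + G₁ t ^ 2) ^ ((1 - 3 * p) / 2) +
        |G₀ t * h₁ t - G₁ t * h₀ t| ^ p * ((1 - 3 * p) / 2 *
          (G₀ t ^ 2 + G₁ t ^ 2) ^ ((1 - 3 * p) / 2 - 1) *
          (2 * (G₀ t * (deriv φ t * e 0) + G₁ t * (deriv φ t * e 1))))) =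
        (∫ t in Ioo (0 : ℝ) 1, deriv (deriv φ) t * (p * U t * (G₀ t * e 1 - G₁ t * e 0))) +
        ∫ t in Ioo (0 : ℝ) 1, deriv φ t * (p * U t * (e 0 * h₁ t - e 1 * h₀ t) +
      (1 - 3 * p) * (|G₀ t * h₁ t - G₁ t * h₀ t| ^ p *
      (G₀ t ^ 2 + G₁ t ^ 2) ^ ((1 - 3 * p) / 2 - 1)) * (G₀ t * e 0 + G₁ t * e 1)) := by
      rw [← integral_add h1 h2]
      refine setIntegral_congr_fun measurableSet_Ioo fun t _ => ?_
      simp only [hU]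
      ring
    have e2 : ∫ t in Ioo (0 : ℝ) 1, 1 / 2 * (G₀ t ^ 2 + G₁ t ^ 2) ^ (1 / 2 - 1 : ℝ) *
          (2 * (G₀ t * (deriv φ t * e 0) + G₁ t * (deriv φ t * e 1))) =
        ∫ t in Ioo (0 : ℝ) 1, deriv φ t * ((G₀ t ^ 2 + G₁ t ^ 2) ^ (1 / 2 - 1 : ℝ) *
          (G₀ t * e 0 + G₁ t * e 1)) := by
      refine setIntegral_congr_fun measurableSet_Ioo fun t _ => ?_
      simp only
      ring
    rw [e1, e2, ← integral_const_mul, ← integral_add h1 h2] at hv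
    have h12 : IntegrableOn (fun t => deriv (deriv φ) t * (p * U t * (G₀ t * e 1 - G₁ t * e 0)) +
        deriv φ t * (p * U t * (e 0 * h₁ t - e 1 * h₀ t) +
      (1 - 3 * p) * (|G₀ t * h₁ t - G₁ t * h₀ t| ^ p *
      (G₀ t ^ 2 + G₁ t ^ 2) ^ ((1 - 3 * p) / 2 - 1)) * (G₀ t * e 0 + G₁ t * e 1))) (Ioo 0 1) :=
      h1.add h2
    rw [← integral_add h12 (h3.const_mul lam)] at hv
    refine Eq.trans ?_ hv
    refine setIntegral_congr_fun measurableSet_Ioo fun t _ => ?_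
    simp only [hS]
    ring

/-- The Euler--Lagrange equation, integrated once by means of the constant vector `(C₀, C₁)`. -/
theorem IsSobolevRep.euler_lagrange (hp : 1 < p) (h : IsSobolevRep p c G₀ G₁ h₀ h₁)
    {lam : ℝ} (hcrit : ∀ η : ℝ → Plane, IsTestFunction 0 1 η →
      HasDerivAt (fun ε : ℝ =>
        bendingEnergy p 0 1 (c + ε • η) + lam * curveLength 0 1 (c + ε • η)) 0 0) :
    ∃ (C₀ C₁ : ℝ) (w : ℝ → ℝ), AbsolutelyContinuousOnInterval w 0 1 ∧
      (∀ᵐ t ∂volume.restrict (Ioo (0 : ℝ) 1),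
        HasDerivAt w ((C₁ * G₀ t - C₀ * G₁ t) / p) t) ∧
      (∀ᵐ t ∂volume.restrict (Ioo (0 : ℝ) 1),
        (G₀ t * h₁ t - G₁ t * h₀ t) * (G₀ t ^ 2 + G₁ t ^ 2) ^ (-(3 / 2) : ℝ) =
          spow (p - 1)⁻¹ (w t)) ∧
      ∀ᵐ t ∂volume.restrict (Ioo (0 : ℝ) 1),
        (1 - p) * |spow (p - 1)⁻¹ (w t)| ^ p * (G₀ t ^ 2 + G₁ t ^ 2) ^ (1 / 2 : ℝ) +
          lam * (G₀ t ^ 2 + G₁ t ^ 2) ^ (1 / 2 : ℝ) + C₀ * G₀ t + C₁ * G₁ t = 0 := by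
  have hp0 : 0 < p := by linarith
  have hp1 : 0 < p - 1 := by linarith
  set U : ℝ → ℝ := fun t => spow (p - 1) (G₀ t * h₁ t - G₁ t * h₀ t) *
      (G₀ t ^ 2 + G₁ t ^ 2) ^ ((1 - 3 * p) / 2) with hU
  set S : ℝ → ℝ := fun t => (1 - 3 * p) * (|G₀ t * h₁ t - G₁ t * h₀ t| ^ p *
      (G₀ t ^ 2 + G₁ t ^ 2) ^ ((1 - 3 * p) / 2 - 1)) +
      lam * (G₀ t ^ 2 + G₁ t ^ 2) ^ (1 / 2 - 1 : ℝ) with hS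
  -- Testing with the two coordinate directions gives Z = p U (-G₁, G₀) almost everywhere, whose
  -- derivative is known up to the constant vector C.
  obtain ⟨a1, a2, a3⟩ := h.weak_euler_lagrange hp hcrit hU hS !₂[1, 0]
  obtain ⟨b1, b2, b3⟩ := h.weak_euler_lagrange hp hcrit hU hS !₂[0, 1]
  obtain ⟨C₀, Z₀, hZ₀c, hZ₀ac, hZ₀d, hZ₀⟩ :=
    exists_absolutelyContinuous_of_weakDeriv_two one_pos a1 a2 a3
  obtain ⟨C₁, Z₁, hZ₁c, hZ₁ac, hZ₁d, hZ₁⟩ :=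
    exists_absolutelyContinuous_of_weakDeriv_two one_pos b1 b2 b3
  have hc0 := h.cont₀
  have hc1 := h.cont₁
  have hw : ∀ᵐ t ∂volume.restrict (Ioo (0 : ℝ) 1),
      (Z₁ t * G₀ t - Z₀ t * G₁ t) / p = U t * (G₀ t ^ 2 + G₁ t ^ 2) := by
    filter_upwards [hZ₀, hZ₁] with t e0 e1
    simp at e0 e1
    rw [← e0, ← e1]
    field_simp
    ring
  have hk : ∀ᵐ t ∂volume.restrict (Ioo (0 : ℝ) 1),
      (G₀ t * h₁ t - G₁ t * h₀ t) * (G₀ t ^ 2 + G₁ t ^ 2) ^ (-(3 / 2) : ℝ) =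
        spow (p - 1)⁻¹ ((Z₁ t * G₀ t - Z₀ t * G₁ t) / p) := by
    filter_upwards [hw] with t ht
    have hN := h.pos t
    -- The exponents agree because (1 - 3p)/2 + 1 = -(3/2)(p - 1).
    have e1 : U t * (G₀ t ^ 2 + G₁ t ^ 2) = spow (p - 1)
        ((G₀ t * h₁ t - G₁ t * h₀ t) * (G₀ t ^ 2 + G₁ t ^ 2) ^ (-(3 / 2) : ℝ)) := by
      rw [spow_mul_of_pos _ (Real.rpow_pos_of_pos hN _), ← Real.rpow_mul hN.le, hU, mul_assoc, ← Real.rpow_add_one hN.ne']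
      congr 2
      ring
    rw [ht, e1, spow_spow hp1, mul_inv_cancel₀ hp1.ne', spow_one]
  -- Z is normal to the curve. By continuity this holds at every point, so it can be differentiated,
  -- which yields the tangential identity.
  have horth : EqOn (fun t => Z₀ t * G₀ t + Z₁ t * G₁ t) (fun _ => 0) (Ioo 0 1) := by
    refine Measure.eqOn_Ioo_of_ae_eq (μ := volume) ?_ (by fun_prop) (by fun_prop)
    filter_upwards [hZ₀, hZ₁] with t e0 e1
    simp at e0 e1
    rw [← e0, ← e1]
    ring
  refine ⟨C₀, C₁, fun t => (Z₁ t * G₀ t - Z₀ t * G₁ t) / p, ?_, ?_, hk, ?_⟩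
  · have h1 := ((hZ₁ac.mul h.ac₀).sub (hZ₀ac.mul h.ac₁)).const_mul p⁻¹
    convert! h1 using 1
    ext t
    simp
    ring
  · filter_upwards [hZ₀, hZ₁, hZ₀d, hZ₁d, h.ae_deriv₀, h.ae_deriv₁] with t e0 e1 d0 d1 g0 g1
    have h1 := ((d1.mul g0).sub (d0.mul g1)).div_const p
    convert! h1 using 1
    simp at e0 e1
    rw [← e0, ← e1]
    simp
    ring
  · filter_upwards [hZ₀, hZ₁, hZ₀d, hZ₁d, h.ae_deriv₀, h.ae_deriv₁, hk,
      ae_restrict_mem measurableSet_Ioo] with t e0 e1 d0 d1 g0 g1 hkt ht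
    have hN := h.pos t
    have h1 := (d0.mul g0).add (d1.mul g1)
    have h2 : HasDerivAt (fun t => Z₀ t * G₀ t + Z₁ t * G₁ t) 0 t :=
      (hasDerivAt_const t (0 : ℝ)).congr_of_eventuallyEq
        (horth.eventuallyEq_of_mem (Ioo_mem_nhds ht.1 ht.2))
    have h3 := h1.unique h2
    simp at e0 e1 h3
    rw [← e0, ← e1] at h3
    rw [← hkt]
    set D := G₀ t * h₁ t - G₁ t * h₀ t with hD
    set N := G₀ t ^ 2 + G₁ t ^ 2 with hNdef
    have h4 : U t * D = |D| ^ p * N ^ ((1 - 3 * p) / 2) := by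
      rw [hU]
      simp only
      rw [← hD, ← mul_spow_self hp0]
      ring
    have h5 : S t * N = (1 - 3 * p) * (|D| ^ p * N ^ ((1 - 3 * p) / 2)) +
        lam * N ^ (1 / 2 : ℝ) := by
      rw [hS]
      simp only
      rw [← hD, ← hNdef, Real.rpow_sub_one hN.ne', Real.rpow_sub_one hN.ne']
      field_simp
    have h6 : |D * N ^ (-(3 / 2) : ℝ)| ^ p * N ^ (1 / 2 : ℝ) =
        |D| ^ p * N ^ ((1 - 3 * p) / 2) := by
      rw [abs_mul, abs_of_pos (Real.rpow_pos_of_pos hN _),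
        Real.mul_rpow (abs_nonneg _) (Real.rpow_nonneg hN.le _), ← Real.rpow_mul hN.le, mul_assoc,
        ← Real.rpow_add hN]
      congr 2
      ring
    rw [mul_assoc, h6]
    rw [hD] at h4
    rw [hNdef] at h5
    -- The term U D occurs once from Z' and once from the derivative of G, and 2p + (1 - 3p) = 1 -
    -- p.
    linear_combination h3 - 2 * p * h4 - h5

end EulerLagrange

/-! ### Passage to the arclength parameter. -/

section Reparametrization

/-- The arclength function of a speed bounded below is invertible, with differentiable inverse. -/
theorem exists_inverse_arclength {v : ℝ → ℝ} (hv : Continuous v) {m : ℝ} (hm : 0 < m)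
    (hmv : ∀ t, m ≤ v t) :
    ∃ τ : ℝ → ℝ, Monotone τ ∧ (∀ s, ∫ r in (0 : ℝ)..τ s, v r = s) ∧
      (∀ t, τ (∫ r in (0 : ℝ)..t, v r) = t) ∧ ∀ s, HasDerivAt τ (v (τ s))⁻¹ s := by
  set σ : ℝ → ℝ := fun t => ∫ r in (0 : ℝ)..t, v r with hσ
  have hd : ∀ t, HasDerivAt σ (v t) t := fun t => (hv.integral_hasStrictDerivAt 0 t).hasDerivAt
  have hσc : Continuous σ := continuous_iff_continuousAt.2 fun t => (hd t).continuousAt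
  have hmono : StrictMono σ := strictMono_of_deriv_pos fun t => by
    rw [(hd t).deriv]; exact hm.trans_le (hmv t)
  -- Linear growth makes σ tend to ±∞, hence onto.
  have hgrow : Monotone fun t => σ t - m * t := by
    have hd' : ∀ t, HasDerivAt (fun t => σ t - m * t) (v t - m) t := fun t => by
      have h1 := (hd t).sub ((hasDerivAt_id t).const_mul m)
      rw [mul_one] at h1
      exact h1
    refine monotone_of_deriv_nonneg (fun t => (hd' t).differentiableAt) fun t => ?_
    rw [(hd' t).deriv]
    linarith [hmv t]
  have hσ0 : σ 0 = 0 := by simp [hσ]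
  have htop : Tendsto σ atTop atTop := by
    refine tendsto_atTop_mono' atTop ?_ (tendsto_id.const_mul_atTop hm)
    filter_upwards [eventually_ge_atTop 0] with t ht
    have := hgrow ht
    simp only [hσ0] at this
    simp only [id]
    linarith
  have hbot : Tendsto σ atBot atBot := by
    refine tendsto_atBot_mono' atBot ?_ (tendsto_id.const_mul_atBot hm)
    filter_upwards [eventually_le_atBot 0] with t ht
    have := hgrow ht
    simp only [hσ0] at this
    simp only [id]
    linarith
  set e := hmono.orderIsoOfSurjective σ (hσc.surjective htop hbot) with he
  have h1 : ∀ s, σ (e.symm s) = s := fun s => e.apply_symm_apply s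
  refine ⟨e.symm, e.symm.monotone, h1, fun t => e.symm_apply_apply t, fun s => ?_⟩
  exact (hd (e.symm s)).of_local_left_inverse e.symm.continuous.continuousAt
    (hm.trans_le (hmv _)).ne' (Eventually.of_forall h1)

variable {p : ℝ} {c : ℝ → Plane} {G₀ G₁ h₀ h₁ : ℝ → ℝ}

theorem IsSobolevRep.norm_velocity (h : IsSobolevRep p c G₀ G₁ h₀ h₁) {t : ℝ}
    (ht : t ∈ Icc (0 : ℝ) 1) :
    ‖velocity 0 1 c t‖ = (G₀ t ^ 2 + G₁ t ^ 2) ^ (1 / 2 : ℝ) := by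
  have hv : velocity 0 1 c t = !₂[G₀ t, G₁ t] :=
    (hasDerivWithinAt_plane (h.deriv₀ t ht) (h.deriv₁ t ht)).derivWithin
      (uniqueDiffOn_Icc one_pos t ht)
  rw [hv, norm_plane]

theorem absolutelyContinuous_rpow_const {N : ℝ → ℝ} {a b : ℝ}
    (hN : AbsolutelyContinuousOnInterval N a b) (hpos : ∀ t ∈ uIcc a b, 0 < N t) (q : ℝ) :
    AbsolutelyContinuousOnInterval (fun t => N t ^ q) a b := by
  obtain ⟨x, hxI, hx⟩ := isCompact_uIcc.exists_isMinOn nonempty_uIcc hN.continuousOn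
  obtain ⟨y, -, hy⟩ := isCompact_uIcc.exists_isMaxOn nonempty_uIcc hN.continuousOn
  have hF : ContDiffOn ℝ 1 (fun z : ℝ => z ^ q) (Icc (N x) (N y)) :=
    contDiffOn_id.rpow_const_of_ne fun z hz => ((hpos x hxI).trans_le hz.1).ne'
  obtain ⟨K, hK⟩ := hF.exists_lipschitzOnWith one_ne_zero (convex_Icc _ _) isCompact_Icc
  have hmaps : MapsTo N (uIcc a b) (Icc (N x) (N y)) := fun t ht =>
    ⟨isMinOn_iff.1 hx t ht, isMaxOn_iff.1 hy t ht⟩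
  exact absolutelyContinuous_comp_lipschitz (F := fun z : ℝ => z ^ q) hN hmaps hK

theorem IsSobolevRep.absolutelyContinuous_rpow (h : IsSobolevRep p c G₀ G₁ h₀ h₁) (q : ℝ) :
    AbsolutelyContinuousOnInterval (fun t => (G₀ t ^ 2 + G₁ t ^ 2) ^ q) 0 1 := by
  have hN : AbsolutelyContinuousOnInterval (fun t => G₀ t ^ 2 + G₁ t ^ 2) 0 1 := by
    have h1 := (h.ac₀.mul h.ac₀).add (h.ac₁.mul h.ac₁)
    convert! h1 using 1
    ext t
    simp
    ring
  exact absolutelyContinuous_rpow_const hN (fun t _ => h.pos t) q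

theorem IsSobolevRep.ae_deriv_tangent (h : IsSobolevRep p c G₀ G₁ h₀ h₁) :
    ∀ᵐ t ∂volume.restrict (Ioo (0 : ℝ) 1),
      HasDerivAt (fun t => G₀ t * (G₀ t ^ 2 + G₁ t ^ 2) ^ (-(1 / 2) : ℝ))
        (-((G₀ t * h₁ t - G₁ t * h₀ t) * (G₀ t ^ 2 + G₁ t ^ 2) ^ (-(3 / 2) : ℝ) * G₁ t)) t ∧
      HasDerivAt (fun t => G₁ t * (G₀ t ^ 2 + G₁ t ^ 2) ^ (-(1 / 2) : ℝ))
        ((G₀ t * h₁ t - G₁ t * h₀ t) * (G₀ t ^ 2 + G₁ t ^ 2) ^ (-(3 / 2) : ℝ) * G₀ t) t := by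
  filter_upwards [h.ae_deriv₀, h.ae_deriv₁] with t g0 g1
  have hN := h.pos t
  have e1 := ((g0.pow 2).add (g1.pow 2)).rpow_const (p := (-(1 / 2) : ℝ)) (Or.inl hN.ne')
  have e2 : (G₀ t ^ 2 + G₁ t ^ 2) ^ (-(1 / 2) : ℝ) =
      (G₀ t ^ 2 + G₁ t ^ 2) ^ (-(3 / 2) : ℝ) * (G₀ t ^ 2 + G₁ t ^ 2) := by
    rw [← Real.rpow_add_one hN.ne']; norm_num
  have e3 : (-(1 / 2) : ℝ) - 1 = -(3 / 2) := by norm_num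
  rw [e3] at e1
  constructor
  · have := g0.mul e1
    convert! this using 1
    simp only [Pi.add_apply, Pi.pow_apply]
    rw [e2]
    push_cast
    ring
  · have := g1.mul e1
    convert! this using 1
    simp only [Pi.add_apply, Pi.pow_apply]
    rw [e2]
    push_cast
    ring

theorem exists_isElasticaFrame {L lam : ℝ} {γ : ℝ → Plane} (hp : 1 < p)
    (h : IsSobolevRep p c G₀ G₁ h₀ h₁)
    (hcrit : ∀ η : ℝ → Plane, IsTestFunction 0 1 η →
      HasDerivAt (fun ε : ℝ =>
        bendingEnergy p 0 1 (c + ε • η) + lam * curveLength 0 1 (c + ε • η)) 0 0)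
    (hγ : IsArclengthParameterization c L γ) :
    ∃ C₀ C₁ T₀ T₁ w, IsElasticaFrame p lam C₀ C₁ L γ T₀ T₁ w := by
  obtain ⟨C₀, C₁, w, hwac, hwd, hk, htan⟩ := h.euler_lagrange hp hcrit
  have hc0 := h.cont₀
  have hc1 := h.cont₁
  have hα : 0 < (p - 1)⁻¹ := inv_pos.2 (sub_pos.2 hp)
  have hwc : ContinuousOn w (Icc 0 1) := by
    have := hwac.continuousOn
    rwa [uIcc_of_le zero_le_one] at this
  have hκc : ContinuousOn (fun t => spow (p - 1)⁻¹ (w t)) (Icc 0 1) :=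
    (continuous_spow hα).comp_continuousOn hwc
  have hwD : ∀ t ∈ Icc (0 : ℝ) 1,
      HasDerivWithinAt w ((C₁ * G₀ t - C₀ * G₁ t) / p) (Icc 0 1) t := fun t ht =>
    hasDerivWithinAt_of_absolutelyContinuous one_pos hwac
      (g := fun t => (C₁ * G₀ t - C₀ * G₁ t) / p) (by fun_prop) hwd ht
  set τ₀ : ℝ → ℝ := fun t => G₀ t * (G₀ t ^ 2 + G₁ t ^ 2) ^ (-(1 / 2) : ℝ) with hτ₀
  set τ₁ : ℝ → ℝ := fun t => G₁ t * (G₀ t ^ 2 + G₁ t ^ 2) ^ (-(1 / 2) : ℝ) with hτ₁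
  have hτ₀D : ∀ t ∈ Icc (0 : ℝ) 1,
      HasDerivWithinAt τ₀ (-(spow (p - 1)⁻¹ (w t) * G₁ t)) (Icc 0 1) t := fun t ht => by
    refine hasDerivWithinAt_of_absolutelyContinuous one_pos
      (h.ac₀.mul (h.absolutelyContinuous_rpow _))
      (g := fun t => -(spow (p - 1)⁻¹ (w t) * G₁ t)) (by fun_prop) ?_ ht
    filter_upwards [hk, h.ae_deriv_tangent] with s hs hs'
    rw [← hs]
    exact hs'.1
  have hτ₁D : ∀ t ∈ Icc (0 : ℝ) 1,
      HasDerivWithinAt τ₁ (spow (p - 1)⁻¹ (w t) * G₀ t) (Icc 0 1) t := fun t ht => by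
    refine hasDerivWithinAt_of_absolutelyContinuous one_pos
      (h.ac₁.mul (h.absolutelyContinuous_rpow _))
      (g := fun t => spow (p - 1)⁻¹ (w t) * G₀ t) (by fun_prop) ?_ ht
    filter_upwards [hk, h.ae_deriv_tangent] with s hs hs'
    rw [← hs]
    exact hs'.2
  have hcτ₀ : Continuous τ₀ := hc0.mul (h.continuous_rpow _)
  have hcτ₁ : Continuous τ₁ := hc1.mul (h.continuous_rpow _)
  have hinv : ∀ t, (G₀ t ^ 2 + G₁ t ^ 2) ^ (-(1 / 2) : ℝ) =
      ((G₀ t ^ 2 + G₁ t ^ 2) ^ (1 / 2 : ℝ))⁻¹ := fun t => Real.rpow_neg (h.pos t).le _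
  have hvpos : ∀ t, 0 < (G₀ t ^ 2 + G₁ t ^ 2) ^ (1 / 2 : ℝ) := fun t =>
    Real.rpow_pos_of_pos (h.pos t) _
  -- Divided by the speed, the almost everywhere identity has a continuous left-hand side and so
  -- holds at every point, end points included.
  have htan' : EqOn (fun t => (1 - p) * |spow (p - 1)⁻¹ (w t)| ^ p + lam + C₀ * τ₀ t + C₁ * τ₁ t)
      (fun _ => 0) (Icc 0 1) := by
    refine Measure.eqOn_Icc_of_ae_eq volume (by norm_num) ?_ ?_ continuousOn_const
    · rw [← restrict_Ioo_eq_restrict_Icc]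
      filter_upwards [htan] with t ht
      simp only [hτ₀, hτ₁]
      rw [hinv]
      have := (hvpos t).ne'
      generalize |spow (p - 1)⁻¹ (w t)| ^ p = X at ht ⊢
      field_simp
      linear_combination ht
    · have h1 : ContinuousOn (fun t => |spow (p - 1)⁻¹ (w t)| ^ p) (Icc 0 1) :=
        hκc.abs.rpow_const fun _ _ => Or.inr (by linarith)
      fun_prop
  -- Clamping the parameter to [0, 1] gives the speed a positive lower bound on the whole line, so
  -- its arclength function has a global inverse.
  set v : ℝ → ℝ := fun t =>
    (G₀ (max 0 (min t 1)) ^ 2 + G₁ (max 0 (min t 1)) ^ 2) ^ (1 / 2 : ℝ) with hv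
  have hvc : Continuous v := (h.continuous_rpow (1 / 2)).comp
    (g := fun t => (G₀ t ^ 2 + G₁ t ^ 2) ^ (1 / 2 : ℝ)) (f := fun t : ℝ => max 0 (min t 1))
    (by fun_prop)
  have hvI : ∀ t ∈ Icc (0 : ℝ) 1, v t = (G₀ t ^ 2 + G₁ t ^ 2) ^ (1 / 2 : ℝ) := fun t ht => by
    simp only [hv, min_eq_left ht.2, max_eq_right ht.1]
  obtain ⟨x, -, hx⟩ := isCompact_Icc.exists_isMinOn (nonempty_Icc.2 (zero_le_one (α := ℝ)))
    (h.continuous_rpow (1 / 2)).continuousOn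
  obtain ⟨τ, hτm, hστ, hτσ, hτd⟩ := exists_inverse_arclength hvc (hvpos x) fun t =>
    isMinOn_iff.1 hx _ ⟨le_max_left _ _, max_le zero_le_one (min_le_right _ _)⟩
  have hlen : ∀ t ∈ Icc (0 : ℝ) 1,
      ∫ r in Ioo (0 : ℝ) t, ‖velocity 0 1 c r‖ = ∫ r in (0 : ℝ)..t, v r := fun t ht => by
    rw [← integral_Ioo_eq ht.1]
    refine setIntegral_congr_fun measurableSet_Ioo fun r hr => ?_
    have hr' : r ∈ Icc (0 : ℝ) 1 := ⟨hr.1.le, hr.2.le.trans ht.2⟩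
    simp only [h.norm_velocity hr', hvI r hr']
  have hL1 : ∫ r in (0 : ℝ)..1, v r = L := by
    rw [← hlen 1 (by simp)]
    exact hγ.1
  have hτL : τ L = 1 := by rw [← hL1]; exact hτσ 1
  have hτ0 : τ 0 = 0 := by simpa using hτσ 0
  have hmaps : MapsTo τ (Icc 0 L) (Icc 0 1) := fun s hs =>
    ⟨hτ0 ▸ hτm hs.1, hτL ▸ hτm hs.2⟩
  have hγc : ∀ s ∈ Icc 0 L, γ s = c (τ s) := fun s hs => by
    rw [← hγ.2 (τ s) (hmaps hs), hlen _ (hmaps hs), hστ]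
  have hcomp : ∀ {f : ℝ → ℝ} {g : ℝ → ℝ},
      (∀ t ∈ Icc (0 : ℝ) 1, HasDerivWithinAt f (g t) (Icc 0 1) t) → ∀ s ∈ Icc 0 L,
      HasDerivWithinAt (fun s => f (τ s))
        (g (τ s) * (G₀ (τ s) ^ 2 + G₁ (τ s) ^ 2) ^ (-(1 / 2) : ℝ)) (Icc 0 L) s := by
    intro f g hfg s hs
    have h1 := (hfg (τ s) (hmaps hs)).comp s (hτd s).hasDerivWithinAt hmaps
    rw [hvI _ (hmaps hs), ← hinv] at h1
    exact h1
  refine ⟨C₀, C₁, fun s => τ₀ (τ s), fun s => τ₁ (τ s), fun s => w (τ s), ?_, ?_, ?_, ?_, ?_, ?_, ?_⟩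
  · intro s hs
    exact (hcomp h.deriv₀ s hs).congr (fun r hr => by rw [hγc r hr]) (by rw [hγc s hs])
  · intro s hs
    exact (hcomp h.deriv₁ s hs).congr (fun r hr => by rw [hγc r hr]) (by rw [hγc s hs])
  · intro s hs
    convert! hcomp hτ₀D s hs using 1
    simp only [hτ₁]
    ring
  · intro s hs
    convert! hcomp hτ₁D s hs using 1
    simp only [hτ₀]
    ring
  · intro s hs
    convert! hcomp hwD s hs using 1
    simp only [hτ₀, hτ₁]
    ring
  · intro s hs
    simp only [hτ₀, hτ₁]
    rw [hinv]
    have h1 := h.pos (τ s)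
    rw [← Real.sqrt_eq_rpow]
    have h2 := Real.sq_sqrt h1.le
    have h3 := (Real.sqrt_pos.2 h1).ne'
    field_simp
    exact h2.symm
  · intro s hs
    exact htan' (hmaps hs)

end Reparametrization

end PElastica

theorem theorem1p3 (p L : ℝ) (hp : 1 < p) (hL : 0 < L)
    (γ : ℝ → PElastica.Plane) (hγ : PElastica.IsArclengthPElastica p L γ) :
    PElastica.MemSobolev 3 1 0 L γ ∧
    ContDiffOn ℝ 2 γ (Set.Icc 0 L) ∧
    AnalyticOn ℝ γ
      (Set.Icc 0 L \ PElastica.relBoundary (Set.Icc 0 L) (PElastica.curvatureZeroSet L γ)) := by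
  obtain ⟨c, ⟨hc, lam, hcrit⟩, harc⟩ := hγ
  obtain ⟨G₀, G₁, h₀, h₁, hrep⟩ := hc.exists_rep hp
  obtain ⟨C₀, C₁, T₀, T₁, w, hframe⟩ := PElastica.exists_isElasticaFrame hp hrep hcrit harc
  exact ⟨hframe.memSobolev hp hL, hframe.contDiffOn hp hL, hframe.analyticOn hL⟩
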